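/- Let $K=\mathbb{Q}(\theta)$ be a number field generated by a root $\theta$ of a monic irreducible trinomial $F(x)=x^n+ax^m+b\in\mathbb{Z}[x]$ with $0<m<n$. Let $p$ be an odd prime such that $p\nmid a$, $p\mid b$ and $p\mid n-m$, and write $n-m=u\cdot p^k$ with $p\nmid u$. Let $\nu_p$ denote the $p$-adic valuation on $\mathbb{Q}$ (with $\nu_p(0)=\infty$), and put $\delta=\nu_p(b)$ and $\kappa=\nu_p(a^{p-1}-1)$. For positive integers $d,s$ and $p$-integral $t,c\in\mathbb{Q}$, with a bar denoting reduction modulo $p$, let $N_p(d)$ be the number of monic irreducible polynomials of degree $d$ in $\mathbb{F}_p[x]$, let $N_p(d,s,t)$ be the number of monic irreducible factors of degree $d$ of $x^s+\overline{t}$ in $\mathbb{F}_p[x]$, and let $N_p(d,s,t)[m,c]$ be the number of those factors which do not divide $x^m+\overline{c}$. Suppose that for some positive integer $d$ one of the following conditions holds: 1. $\delta<\min\{\kappa,k+1\}$ and $N_p(d)<\delta\, N_p(d,u,a)$; 2. $\kappa<\min\{\delta,k+1\}$ and $N_p(d)<\kappa\, N_p(d,u,a)$; 3. $\kappa=\delta\le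 k$ and $N_p(d)<\kappa\, N_p(d,u,a)\left[m,\frac{b}{a+(-a)^{p^k}}\right]$ (here $\frac{b}{a+(-a)^{p^k}}$ is a $p$-adic unit); 4. $k+1\le\min\{\kappa,\delta\}$ and $N_p(d)<(k+1)\, N_p(d,u,a)$. Then $p$ divides $i(K)=\gcd\{(\mathbb{Z}_K:\mathbb{Z}[\eta]) : \eta\in\mathbb{Z}_K,\ K=\mathbb{Q}(\eta)\}$, where $\mathbb{Z}_K$ is the ring of integers of $K$; and $K$ is not monogenic, that is, there is no $\eta\in\mathbb{Z}_K$ with $\mathbb{Z}_K=\mathbb{Z}[\eta]$. -/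

import Mathlib

open Polynomial

/-- `N_p(d)`: the number of monic irreducible polynomials of degree `d` in `𝔽_p[x]`. -/
noncomputable def numIrred (p d : ℕ) : ℕ :=
  {g : (ZMod p)[X] | g.Monic ∧ Irreducible g ∧ g.natDegree = d}.ncard

/-- `N_p(d, s, t)`: the number of monic irreducible factors of degree `d` of `x ^ s + t`
in `𝔽_p[x]`. -/
noncomputable def numFactors (p d s : ℕ) (t : ZMod p) : ℕ :=
  {g : (ZMod p)[X] | g.Monic ∧ Irreducible g ∧ g.natDegree = d ∧ g ∣ X ^ s + C t}.ncard

/-- `N_p(d, s, t)[m, c]`: the number of monic irreducible factors of degree `d` of `x ^ s + t`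
in `𝔽_p[x]` which do not divide `x ^ m + c`. -/
noncomputable def numFactorsAvoiding (p d s : ℕ) (t : ZMod p) (m : ℕ) (c : ZMod p) : ℕ :=
  {g : (ZMod p)[X] | g.Monic ∧ Irreducible g ∧ g.natDegree = d ∧ g ∣ X ^ s + C t ∧
    ¬ g ∣ X ^ m + C c}.ncard

/-- `K` is monogenic: its ring of integers is `ℤ[η]` for some integral `η`. -/
def FieldIsMonogenic (K : Type*) [Field K] : Prop :=
  ∃ η : NumberField.RingOfIntegers K, Algebra.adjoin ℤ {η} = ⊤

/-- The index `(ℤ_K : ℤ[η])` of an algebraic integer `η` of `K`, as additive groups. -/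
noncomputable def elementIndex {K : Type*} [Field K] (η : NumberField.RingOfIntegers K) : ℕ :=
  (Algebra.adjoin ℤ {η}).toSubmodule.toAddSubgroup.index

/-- The indices `(ℤ_K : ℤ[η])`, where `η` runs over the integers of `K` with `K = ℚ(η)`. -/
def primitiveIndices (K : Type*) [Field K] [NumberField K] : Set ℤ :=
  {i | ∃ η : NumberField.RingOfIntegers K,
    IntermediateField.adjoin ℚ {(η : K)} = ⊤ ∧ i = (elementIndex η : ℤ)}

/-- `i(K)`, the greatest common divisor of all `(ℤ_K : ℤ[η])` with `η` integral and
`K = ℚ(η)`; it is the nonnegative generator of the ideal of `ℤ` spanned by these numbers. -/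
noncomputable def fieldIndex (K : Type*) [Field K] [NumberField K] : ℕ :=
  (Submodule.IsPrincipal.generator (Ideal.span (primitiveIndices K))).natAbs

/-- The defining property of the greatest common divisor. -/
theorem dvd_fieldIndex_iff (K : Type*) [Field K] [NumberField K] (q : ℕ) :
    q ∣ fieldIndex K ↔ ∀ η : NumberField.RingOfIntegers K,
      IntermediateField.adjoin ℚ {(η : K)} = ⊤ → q ∣ elementIndex η := by
  have h : q ∣ fieldIndex K ↔ Ideal.span (primitiveIndices K) ≤ Ideal.span {(q : ℤ)} := by
    rw [← Ideal.span_singleton_generator (Ideal.span (primitiveIndices K)),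
      Ideal.span_singleton_le_span_singleton]
    exact Int.natCast_dvd.symm
  rw [h, Ideal.span_le]
  constructor
  · intro hs η hη
    exact Int.natCast_dvd_natCast.mp (Ideal.mem_span_singleton.mp (hs ⟨η, hη, rfl⟩))
  · rintro hs _ ⟨η, hη, rfl⟩
    exact Ideal.mem_span_singleton.mpr (Int.natCast_dvd_natCast.mpr (hs η hη))

/-! Write F for the trinomial. Modulo `p` it is x^m (x^u + a)^(p^k). Let r = min(δ, κ, k+1). The
heart of the proof is `le_card_primesOverFactor`: over each irreducible factor g of x^u + a that is
counted in the hypothesis there are at least r primes of residue degree deg g. Different g have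
different primes over them, so `p` has more primes of residue degree d than there are monic
irreducible polynomials of degree d. If `p` did not divide (ℤ_K : ℤ[η]), then sending P to the
minimal polynomial of η modulo P would embed these primes into those polynomials
(`dvd_fieldIndex_of_numIrred_lt`).

The r primes are found from norms, without Newton polygons. Lift g to a factor φ of x^u + a' modulo
p^(r+1), for a suitable a' ≡ a (`FactorHasLift`). For P over g let f be its residue degree, t the
valuation of φ(θ) and e that of `p`. The resultants of F with φ and with φ^M + p are norms
(`absNorm_span_aeval`), and yield Σ f t = r deg g and Σ f e = p^k deg g.

The effect of p-th powers on distances (`AddValuation.map_sub_of_map_pow_sub`) forces e/t to be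
p^(k+1-r) or p^(k+1-r) (p-1) p^j with j < r-1. These r numbers add up to p^k, and for p ≥ 3 no other
combination of total weight at most r does (`Nat.unique_minimal_sum_totient`). The weights (f / deg
g) t have total r, so every ratio occurs at exactly one prime over g, with weight one; there f = deg
g. -/

namespace Polynomial

/-! ### Resultants with a monic polynomial and their exact powers of `p`. -/

section MonicResultant

variable {R : Type*} [CommRing R]

/-- Raising the formal degree of `g` multiplies the resultant by a power of the leading coefficient
of `f`, here 1. Hence drops of degree in sums, products and reductions do no harm. -/
theorem Monic.resultant_eq_of_natDegree_le {f : R[X]} (hf : f.Monic) (g : R[X]) {n : ℕ}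
    (hn : g.natDegree ≤ n) : resultant f g f.natDegree n = resultant f g := by
  obtain ⟨k, rfl⟩ := Nat.exists_eq_add_of_le hn
  rw [resultant_add_right_deg _ _ _ _ _ le_rfl, hf.coeff_natDegree, one_pow, one_mul]

theorem Monic.resultant_mul {f : R[X]} (hf : f.Monic) (g h : R[X]) :
    resultant f (g * h) = resultant f g * resultant f h := by
  rw [← resultant_mul_right f g h _ le_rfl, hf.resultant_eq_of_natDegree_le _ natDegree_mul_le]

theorem Monic.resultant_pow {f : R[X]} (hf : f.Monic) (g : R[X]) (k : ℕ) :
    resultant f (g ^ k) = resultant f g ^ k := by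
  induction k with
  | zero => simp
  | succ k ih => rw [pow_succ, hf.resultant_mul, ih, pow_succ]

theorem Monic.resultant_add_mul_self {f : R[X]} (hf : f.Monic) (g q : R[X]) :
    resultant f (g + f * q) = resultant f g := by
  set n := max (q.natDegree + f.natDegree) g.natDegree
  have h1 : (g + f * q).natDegree ≤ n :=
    (natDegree_add_le _ _).trans (max_le (le_max_right _ _)
      (natDegree_mul_le.trans ((add_comm _ _).le.trans (le_max_left _ _))))
  rw [← hf.resultant_eq_of_natDegree_le _ h1,
    resultant_add_mul_right _ _ _ _ _ (le_max_left _ _) le_rfl,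
    hf.resultant_eq_of_natDegree_le _ (le_max_right _ _)]

theorem Monic.resultant_map {S : Type*} [CommRing S] {f : R[X]} (hf : f.Monic) (g : R[X])
    (φ : R →+* S) : φ (resultant f g) = resultant (f.map φ) (g.map φ) := by
  nontriviality S
  rw [← resultant_map_map, ← (hf.map φ).resultant_eq_of_natDegree_le _ (natDegree_map_le (f := φ)),
    hf.natDegree_map]

theorem natAbs_resultant_comm (f g : ℤ[X]) :
    (resultant f g).natAbs = (resultant g f).natAbs := by
  rw [resultant_comm, Int.natAbs_mul, Int.natAbs_pow]
  simp

theorem not_dvd_resultant_of_isCoprime {p : ℕ} [Fact p.Prime] {f g : ℤ[X]} (hf : f.Monic)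
    (h : IsCoprime (f.map (Int.castRingHom (ZMod p))) (g.map (Int.castRingHom (ZMod p)))) :
    ¬ (p : ℤ) ∣ resultant f g := by
  rw [← ZMod.intCast_zmod_eq_zero_iff_dvd]
  change Int.castRingHom (ZMod p) _ ≠ 0
  rw [hf.resultant_map]
  exact resultant_ne_zero _ _ h

/-- If `F ≡ p ^ r G` modulo `φ`, with `G` coprime to `φ` modulo `p`, then
`p ^ (r * deg φ)` is the exact power of `p` in the resultant of `F` and `φ`. -/
theorem natAbs_resultant_eq_pow_mul {p : ℕ} [Fact p.Prime] {F φ G Q : ℤ[X]} (hφ : φ.Monic) (r : ℕ)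
    (h : F = C ((p : ℤ) ^ r) * G + φ * Q)
    (hG : IsCoprime (φ.map (Int.castRingHom (ZMod p))) (G.map (Int.castRingHom (ZMod p)))) :
    ∃ c : ℕ, ¬ p ∣ c ∧ (resultant F φ).natAbs = p ^ (r * φ.natDegree) * c := by
  refine ⟨(resultant φ G).natAbs, ?_, ?_⟩
  · rw [← Int.natCast_dvd]
    exact not_dvd_resultant_of_isCoprime hφ hG
  · rw [natAbs_resultant_comm, h, hφ.resultant_add_mul_self, hφ.resultant_mul,
      resultant_C_right, Int.natAbs_mul, hφ.coeff_natDegree]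
    simp [Int.natAbs_pow, ← pow_mul]

/-- If `F ≡ φ ^ s F₁` modulo `p` with `F₁` coprime to `φ`, then for large `M` the exact power of
`p` in the resultant of `F` and `φ ^ M + p` is `p ^ (s * deg φ)`. -/
theorem natAbs_resultant_pow_add {p : ℕ} [Fact p.Prime] {F φ F₁ F₂ : ℤ[X]} (hφ : φ.Monic)
    (hd : 0 < φ.natDegree) (s M : ℕ) (hM : s < M)
    (h : F = φ ^ s * F₁ + C (p : ℤ) * F₂)
    (hF : IsCoprime (φ.map (Int.castRingHom (ZMod p))) (F₁.map (Int.castRingHom (ZMod p)))) :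
    ∃ c : ℕ, ¬ p ∣ c ∧
      (resultant F (φ ^ M + C (p : ℤ))).natAbs = p ^ (s * φ.natDegree) * c := by
  have hdeg : (C (p : ℤ)).degree < (φ ^ M).degree := by
    refine degree_C_le.trans_lt ?_
    rw [degree_eq_natDegree (hφ.pow M).ne_zero, hφ.natDegree_pow]
    exact_mod_cast Nat.mul_pos (by omega) hd
  have hH : (φ ^ M + C (p : ℤ)).Monic := (hφ.pow M).add_of_left hdeg
  have hM' : φ ^ M = φ ^ s * φ ^ (M - s) := by rw [← pow_add]; congr 1; omega
  have hmap : (φ ^ M + C (p : ℤ)).map (Int.castRingHom (ZMod p)) =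
      (φ.map (Int.castRingHom (ZMod p))) ^ M := by
    simp [Polynomial.map_pow]
  have hφH : (resultant (φ ^ M + C (p : ℤ)) φ).natAbs = p ^ φ.natDegree := by
    have h1 : φ ^ M + C (p : ℤ) = C (p : ℤ) + φ * φ ^ (M - 1) := by
      rw [← pow_succ', Nat.sub_add_cancel (by omega), add_comm]
    rw [natAbs_resultant_comm]
    conv_lhs => rw [h1]
    rw [hφ.resultant_add_mul_self, resultant_C_right]
    simp [hφ.leadingCoeff, Int.natAbs_pow]
  refine ⟨(resultant (φ ^ M + C (p : ℤ)) (F₁ - φ ^ (M - s) * F₂)).natAbs, ?_, ?_⟩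
  · rw [← Int.natCast_dvd]
    refine not_dvd_resultant_of_isCoprime hH ?_
    rw [hmap]
    refine IsCoprime.pow_left ?_
    obtain ⟨j, hj⟩ : ∃ j, M - s = j + 1 := ⟨M - s - 1, by omega⟩
    rw [Polynomial.map_sub, Polynomial.map_mul, Polynomial.map_pow, hj, pow_succ', mul_assoc,
      sub_eq_add_neg, ← mul_neg]
    exact hF.add_mul_left_right _
  -- Modulo φ^M + p the constant `p` equals -φ^M, so φ^s splits off from all of `F`.
  · have h2 : F = φ ^ s * (F₁ - φ ^ (M - s) * F₂) + (φ ^ M + C (p : ℤ)) * F₂ := by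
      rw [h]; linear_combination -F₂ * hM'
    rw [natAbs_resultant_comm]
    conv_lhs => rw [h2]
    rw [hH.resultant_add_mul_self, hH.resultant_mul, hH.resultant_pow, Int.natAbs_mul,
      Int.natAbs_pow, hφH, ← pow_mul, mul_comm s]

end MonicResultant

/-! ### Hensel lifting of coprime factorizations. -/

section Hensel

theorem exists_eq_C_mul_of_map_eq_zero {p : ℕ} {q : ℤ[X]}
    (hq : q.map (Int.castRingHom (ZMod p)) = 0) : ∃ E, q = C (p : ℤ) * E := by
  rw [← dvd_def, C_dvd_iff_dvd_coeff]
  intro i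
  rw [← ZMod.intCast_zmod_eq_zero_iff_dvd]
  simpa using congrArg (fun q => q.coeff i) hq

/-- Every coprime factorization modulo `p` lifts to a factorization modulo `p ^ N`. -/
theorem exists_monic_lift_factor {p : ℕ} [Fact p.Prime] (f : ℤ[X]) {g h : (ZMod p)[X]}
    (hg : g.Monic) (hgh : IsCoprime g h)
    (hf : f.map (Int.castRingHom (ZMod p)) = g * h) (N : ℕ) (hN : 0 < N) :
    ∃ φ ψ E : ℤ[X], φ.Monic ∧ φ.natDegree = g.natDegree ∧
      φ.map (Int.castRingHom (ZMod p)) = g ∧ ψ.map (Int.castRingHom (ZMod p)) = h ∧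
      f = φ * ψ + C ((p : ℤ) ^ N) * E := by
  have hsurj : Function.Surjective (Int.castRingHom (ZMod p)) := ZMod.intCast_surjective
  induction N, hN using Nat.le_induction with
  | base =>
    obtain ⟨φ, hφ, hφd, hφm⟩ := lifts_and_natDegree_eq_and_monic
      ((mem_lifts _).2 (map_surjective _ hsurj g)) hg
    obtain ⟨ψ, hψ⟩ := map_surjective _ hsurj h
    obtain ⟨E, hE⟩ := exists_eq_C_mul_of_map_eq_zero (p := p) (q := f - φ * ψ) (by simp [hf, hφ, hψ])
    exact ⟨φ, ψ, E, hφm, hφd, hφ, hψ, by rw [pow_one]; linear_combination hE⟩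
  | succ N hN ih =>
    obtain ⟨φ, ψ, E, hφm, hφd, hφ, hψ, hE⟩ := ih
    obtain ⟨a, b, hab⟩ := hgh
    set e := E.map (Int.castRingHom (ZMod p))
    -- Reducing the correction of `φ` modulo `g` keeps `φ` monic of the same degree; the quotient
    -- goes into the correction `t` of `ψ`.
    obtain ⟨s, hs, hsd⟩ := exists_degree_eq_of_mem_lifts
      ((mem_lifts _).2 (map_surjective _ hsurj ((e * b) %ₘ g)))
    obtain ⟨t, ht⟩ := map_surjective _ hsurj (e * a + (e * b) /ₘ g * h)
    have hst : (e * b) %ₘ g + g * ((e * b) /ₘ g) = e * b := modByMonic_add_div _ _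
    obtain ⟨E', hE'⟩ := exists_eq_C_mul_of_map_eq_zero (p := p) (q := E - s * ψ - t * φ) (by
      simp only [Polynomial.map_sub, Polynomial.map_mul, hs, ht, hφ, hψ]
      linear_combination -h * hst - e * hab)
    have hdeg : (C ((p : ℤ) ^ N) * s).degree < φ.degree := by
      rw [degree_C_mul (pow_ne_zero _ (by exact_mod_cast (Fact.out : p.Prime).ne_zero))]
      rw [hsd, degree_eq_natDegree hφm.ne_zero, hφd, ← degree_eq_natDegree hg.ne_zero]
      exact degree_modByMonic_lt _ hg
    refine ⟨φ + C ((p : ℤ) ^ N) * s, ψ + C ((p : ℤ) ^ N) * t,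
      E' - C ((p : ℤ) ^ (N - 1)) * s * t, hφm.add_of_left hdeg, ?_, ?_, ?_, ?_⟩
    · rw [natDegree_add_eq_left_of_degree_lt hdeg, hφd]
    · simp [hφ, show N ≠ 0 by omega]
    · simp [hψ, show N ≠ 0 by omega]
    · obtain ⟨j, rfl⟩ : ∃ j, N = j + 1 := ⟨N - 1, by omega⟩
      simp only [Nat.add_sub_cancel, C_pow, C_mul, pow_succ] at hE hE' ⊢
      linear_combination hE + (C (p : ℤ)) ^ j * C (p : ℤ) * hE'

end Hensel

end Polynomial

/-! ### Minimal representations of p^N. -/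

section Digits

/-- Digit by digit, with `s` as the incoming carry: `s + n 0 = 1 + t * p`, and `t` is carried on. A
carry trades p summands for one, so the fewest summands occur when nothing is carried. -/
theorem Nat.digits_one_minimal {p : ℕ} (hp : 2 ≤ p) (N : ℕ) (n : ℕ → ℕ) (s : ℕ)
    (h : s + ∑ j ∈ Finset.range N, n j * p ^ j = ∑ j ∈ Finset.range N, p ^ j) :
    N ≤ s + ∑ j ∈ Finset.range N, n j ∧
      (s = 0 → ∑ j ∈ Finset.range N, n j = N → ∀ j < N, n j = 1) := by
  induction N generalizing n s with
  | zero => simp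
  | succ N ih =>
    simp only [Finset.sum_range_succ', pow_succ, ← mul_assoc, ← Finset.sum_mul] at h ⊢
    set A := ∑ j ∈ Finset.range N, n (j + 1) * p ^ j
    set B := ∑ j ∈ Finset.range N, p ^ j
    simp only [pow_zero, mul_one] at h
    have h0 : s + n 0 ≠ 0 := by
      intro h0
      have : p ∣ 1 := (Nat.dvd_add_right (dvd_mul_left p B)).1 ⟨A, by linarith⟩
      exact absurd (Nat.le_of_dvd one_pos this) (by omega)
    have hAB : A ≤ B := Nat.le_of_mul_le_mul_right (show A * p ≤ B * p by omega) (by omega)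
    obtain ⟨t, ht⟩ := Nat.exists_eq_add_of_le hAB
    have hs : s + n 0 = 1 + t * p := by rw [ht, add_mul] at h; omega
    obtain ⟨h1, h2⟩ := ih (fun j => n (j + 1)) t (by rw [ht]; ring)
    have htp : t * 2 ≤ t * p := Nat.mul_le_mul_left _ hp
    refine ⟨by omega, fun hs0 hsum => ?_⟩
    have ht0 : t = 0 := by omega
    subst ht0
    rintro (_ | j) hj
    · omega
    · exact h2 rfl (by omega) j (by omega)

/-- The representation of `p ^ N` by the lengths `1, p - 1, (p - 1) p, …, (p - 1) p ^ (N - 1)`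
which uses each of them once is the only one with at most `N + 1` summands. -/
theorem Nat.unique_minimal_sum_totient {p : ℕ} (hp : 3 ≤ p) (N : ℕ) (n : ℕ → ℕ)
    (h : n 0 + ∑ j ∈ Finset.range N, n (j + 1) * ((p - 1) * p ^ j) = p ^ N)
    (hle : n 0 + ∑ j ∈ Finset.range N, n (j + 1) ≤ N + 1) :
    ∀ i < N + 1, n i = 1 := by
  obtain ⟨m, rfl⟩ : ∃ m, p = m + 1 := ⟨p - 1, by omega⟩
  have hgeom' : (m + 1) ^ N = 1 + (∑ j ∈ Finset.range N, (m + 1) ^ j) * m := by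
    have h3 := geom_sum_mul ((m : ℤ) + 1) N
    zify
    linarith
  simp only [Nat.add_sub_cancel] at h
  have hsum : ∑ j ∈ Finset.range N, n (j + 1) * (m * (m + 1) ^ j) =
      (∑ j ∈ Finset.range N, n (j + 1) * (m + 1) ^ j) * m := by
    rw [Finset.sum_mul]; exact Finset.sum_congr rfl fun _ _ => by ring
  rw [hsum, hgeom'] at h
  set A := ∑ j ∈ Finset.range N, n (j + 1) * (m + 1) ^ j
  set B := ∑ j ∈ Finset.range N, (m + 1) ^ j
  have h0 : n 0 ≠ 0 := by
    intro h0
    have : m ∣ 1 := (Nat.dvd_add_left (dvd_mul_left m B)).1 ⟨A, by linarith⟩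
    exact absurd (Nat.le_of_dvd one_pos this) (by omega)
  have hAB : A ≤ B := Nat.le_of_mul_le_mul_right (show A * m ≤ B * m by omega) (by omega)
  obtain ⟨t, ht⟩ := Nat.exists_eq_add_of_le hAB
  have hs : n 0 = 1 + t * m := by rw [ht, add_mul] at h; omega
  obtain ⟨h1, h2⟩ := Nat.digits_one_minimal (show 2 ≤ m + 1 by omega) N (fun j => n (j + 1)) t
    (show t + A = B by omega)
  -- The number of summands is at least N + 1 + t (m - 1), so m = p - 1 ≥ 2 forces t = 0.
  have htp : t * 2 ≤ t * m := Nat.mul_le_mul_left _ (by omega)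
  have ht0 : t = 0 := by omega
  subst ht0
  rintro (_ | j) hj
  · omega
  · exact h2 rfl (by omega) j (by omega)

/-- A family of weights `c`, with total at most `N + 1`, on elements labelled by the lengths
`q, q (p - 1), …, q (p - 1) p ^ (N - 1)`, whose weighted sum of lengths is `q * p ^ N`, contains
at least `N + 1` elements of weight one. -/
theorem Finset.card_weight_one {ι : Type*} (T : Finset ι) {p q : ℕ} (hp : 3 ≤ p) (hq : 0 < q)
    (N : ℕ) (c len : ι → ℕ)
    (hlen : ∀ P ∈ T, len P = q ∨ ∃ j < N, len P = q * ((p - 1) * p ^ j))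
    (hsum : ∑ P ∈ T, c P * len P = q * p ^ N) (hle : ∑ P ∈ T, c P ≤ N + 1) :
    N + 1 ≤ (T.filter fun P => c P = 1).card := by
  classical
  have hlab : ∀ P, ∃ i, P ∈ T → i < N + 1 ∧
      len P = q * (if i = 0 then 1 else (p - 1) * p ^ (i - 1)) := by
    intro P
    by_cases hP : P ∈ T
    · rcases hlen P hP with h | ⟨j, hj, h⟩
      · exact ⟨0, fun _ => ⟨by omega, by simp [h]⟩⟩
      · exact ⟨j + 1, fun _ => ⟨by omega, by simp [h]⟩⟩
    · exact ⟨0, fun h => absurd h hP⟩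
  choose lab hlab using hlab
  set n : ℕ → ℕ := fun i => ∑ P ∈ T.filter (fun P => lab P = i), c P with hn
  have hmaps : ∀ P ∈ T, lab P ∈ Finset.range (N + 1) := fun P hP =>
    Finset.mem_range.2 (hlab P hP).1
  have h1 : ∑ i ∈ Finset.range (N + 1), n i = ∑ P ∈ T, c P :=
    Finset.sum_fiberwise_of_maps_to hmaps c
  have h2 : ∑ i ∈ Finset.range (N + 1),
      n i * (if i = 0 then 1 else (p - 1) * p ^ (i - 1)) = p ^ N := by
    refine Nat.eq_of_mul_eq_mul_left hq ?_
    rw [← hsum, ← Finset.sum_fiberwise_of_maps_to hmaps, Finset.mul_sum]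
    refine Finset.sum_congr rfl fun i _ => ?_
    rw [hn, Finset.sum_mul, Finset.mul_sum]
    refine Finset.sum_congr rfl fun P hP => ?_
    obtain ⟨hPT, rfl⟩ := Finset.mem_filter.1 hP
    rw [(hlab P hPT).2]
    ring
  rw [Finset.sum_range_succ'] at h1 h2
  have key := Nat.unique_minimal_sum_totient hp N n (by simpa [add_comm] using h2) (by omega)
  rw [← Finset.card_range (N + 1)]
  refine (Finset.card_le_card (t := (T.filter fun P => c P = 1).image lab) ?_).trans
    Finset.card_image_le
  intro i hi
  have hi1 := key i (Finset.mem_range.1 hi)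
  obtain ⟨P, hP, hc⟩ := Finset.exists_ne_zero_of_sum_ne_zero (hi1.trans_ne one_ne_zero)
  have hc' : c P ≤ n i := Finset.single_le_sum (f := c) (fun _ _ => Nat.zero_le _) hP
  obtain ⟨hPT, hPi⟩ := Finset.mem_filter.1 hP
  exact Finset.mem_image.2 ⟨P, Finset.mem_filter.2 ⟨hPT, by omega⟩, hPi⟩

end Digits

/-! ### Distances under p-th powers. -/

section Valuation

/-- The middle binomial coefficients are divisible by `p`. When `α` is a unit and `x` is not, for a
valuation, the bracket is a unit, and only x^p and p x compete. -/
theorem exists_add_pow_prime_sub_eq {R : Type*} [CommRing R] {p : ℕ} (hp : p.Prime) (α x : R) :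
    ∃ z, (α + x) ^ p - α ^ p = x ^ p + p * x * (α ^ (p - 1) + x * z) := by
  obtain ⟨m, rfl⟩ : ∃ m, p = m + 2 := ⟨p - 2, by have := hp.two_le; omega⟩
  have hdvd : ((m + 2 : ℕ) : R) * x ^ 2 ∣
      ∑ i ∈ Finset.range m, x ^ (i + 1 + 1) * α ^ (m + 2 - (i + 1 + 1)) *
        ((m + 2).choose (i + 1 + 1) : R) := by
    refine Finset.dvd_sum fun i hi => ?_
    have hi := Finset.mem_range.1 hi
    have h1 : ((m + 2 : ℕ) : R) ∣ ((m + 2).choose (i + 1 + 1) : R) :=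
      Nat.cast_dvd_cast (hp.dvd_choose_self (by omega) (by omega))
    rw [mul_comm]
    exact mul_dvd_mul (dvd_mul_of_dvd_left (pow_dvd_pow x (by omega)) _) h1
  obtain ⟨z, hz⟩ := hdvd
  refine ⟨z, ?_⟩
  rw [add_comm α x, add_pow, Finset.sum_range_succ, Finset.sum_range_succ',
    Finset.sum_range_succ', hz]
  simp
  ring

variable {R : Type*} [CommRing R] (v : AddValuation R ℕ∞)

/-- How raising to the `p`-th power moves the distance of two elements. -/
theorem AddValuation.map_pow_prime_sub {p e t : ℕ} (hp : p.Prime) (he : v (p : R) = e)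
    (α y : R) (hα : v α = 0) (hx : v (y - α) = t) (ht : 0 < t) :
    ((p - 1) * t < e → v (y ^ p - α ^ p) = (p * t : ℕ)) ∧
    (e < (p - 1) * t → v (y ^ p - α ^ p) = (t + e : ℕ)) ∧
    ((p - 1) * t = e → (p * t : ℕ) ≤ v (y ^ p - α ^ p)) := by
  obtain ⟨x, rfl⟩ : ∃ x, y = α + x := ⟨y - α, by ring⟩
  rw [add_sub_cancel_left] at hx
  obtain ⟨z, hz⟩ := exists_add_pow_prime_sub_eq hp α x
  have h0 : v (α ^ (p - 1) + x * z) = 0 := by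
    have h1 : v (α ^ (p - 1)) = 0 := by rw [v.map_pow, hα, smul_zero]
    rw [v.map_add_eq_of_lt_left, h1]
    rw [h1, v.map_mul, hx]
    exact lt_of_lt_of_le (by exact_mod_cast ht) le_self_add
  have h3 : p * t = (p - 1) * t + t := by
    obtain ⟨m, rfl⟩ : ∃ m, p = m + 1 := ⟨p - 1, by have := hp.two_le; omega⟩
    rw [Nat.add_sub_cancel]; ring
  have h1 : v (x ^ p) = (p * t : ℕ) := by
    rw [v.map_pow, hx, nsmul_eq_mul]; push_cast; rfl
  have h2 : v (p * x * (α ^ (p - 1) + x * z)) = (t + e : ℕ) := by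
    rw [v.map_mul, v.map_mul, h0, he, hx, add_zero, add_comm]; push_cast; rfl
  rw [hz]
  refine ⟨fun h => ?_, fun h => ?_, fun h => ?_⟩
  · rw [v.map_add_eq_of_lt_left, h1]
    rw [h1, h2]
    exact_mod_cast (by omega : p * t < t + e)
  · rw [v.map_add_eq_of_lt_right, h2]
    rw [h1, h2]
    exact_mod_cast (by omega : t + e < p * t)
  · refine le_trans ?_ (v.map_add _ _)
    rw [h1, h2, show t + e = p * t by omega, min_self]

/-- If `y ^ p ^ k - α ^ p ^ k` has the valuation of `p ^ r`, then the valuation of `y - α` is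
`1 / ((p - 1) p ^ j)` times that of `p` for some `j < k`, or the one remaining value that the
`p`-power map permits. -/
theorem AddValuation.map_sub_of_map_pow_sub {p e : ℕ} (hp : p.Prime) (hp3 : 3 ≤ p)
    (he : v (p : R) = e) (he0 : 0 < e) (k : ℕ) :
    ∀ (α y : R) (t r : ℕ), v α = 0 → v (y - α) = t → 0 < t → 1 ≤ r →
      v (y ^ p ^ k - α ^ p ^ k) = (r * e : ℕ) →
      (r ≤ k + 1 → t * p ^ (k + 1 - r) = e ∨
        ∃ j, k + 1 - r ≤ j ∧ j < k ∧ t * ((p - 1) * p ^ j) = e) ∧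
      (k + 1 ≤ r → t = (r - k) * e ∨ ∃ j < k, t * ((p - 1) * p ^ j) = e) := by
  -- The range r ≥ k + 1 is carried along because the case r = k + 2 of the inductive step lands in
  -- it.
  induction k with
  | zero =>
    intro α y t r hα hx ht hr h
    simp only [pow_zero, pow_one, hx, Nat.cast_inj] at h
    refine ⟨fun hr1 => Or.inl ?_, fun _ => Or.inl (by simpa using h)⟩
    obtain rfl : r = 1 := by omega
    simpa using h
  | succ k ih =>
    intro α y t r hα hx ht hr h
    obtain ⟨s1, s2, s3⟩ := v.map_pow_prime_sub hp he α y hα hx ht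
    rw [pow_succ', pow_mul, pow_mul] at h
    obtain ⟨t', ht'⟩ : ∃ t' : ℕ, v (y ^ p - α ^ p) = t' := by
      obtain ⟨c, hc⟩ := sub_dvd_pow_sub_pow (y ^ p) (α ^ p) (p ^ k)
      have hle : v (y ^ p - α ^ p) ≤ (r * e : ℕ) := by
        rw [← h, hc, v.map_mul]; exact le_self_add
      exact ⟨_, (ENat.natCast_toNat (ne_top_of_le_ne_top (ENat.natCast_ne_top _) hle)).symm⟩
    rw [ht'] at s1 s2 s3
    simp only [Nat.cast_inj, Nat.cast_le] at s1 s2 s3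
    obtain ⟨m, rfl⟩ : ∃ m, p = m + 3 := ⟨p - 3, by omega⟩
    simp only [show m + 3 - 1 = m + 2 by omega] at s1 s2 s3 ih ⊢
    have hmt : (m + 3) * t = (m + 2) * t + t := by ring
    have hmt' : (m + 2) * t = m * t + 2 * t := by ring
    have ht'0 : 0 < t' := by
      rcases lt_trichotomy ((m + 2) * t) e with hlt | heq | hgt
      · rw [s1 hlt]; positivity
      · exact lt_of_lt_of_le (by positivity) (s3 heq)
      · rw [s2 hgt]; positivity
    obtain ⟨i1, i2⟩ := ih (α ^ (m + 3)) (y ^ (m + 3)) t' r (by rw [v.map_pow, hα, smul_zero]) ht'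
      ht'0 hr h
    have hle : ∀ x, 0 < x → t' * x = e → t' ≤ e := fun x hx h =>
      h ▸ Nat.le_mul_of_pos_right t' hx
    have hpos : ∀ j, 0 < (m + 3) ^ j := fun j => by positivity
    have hpos' : ∀ j, 0 < (m + 2) * (m + 3) ^ j := fun j => by positivity
    refine ⟨fun hr1 => ?_, fun hr1 => ?_⟩
    · by_cases hrk : r ≤ k + 1
      · have hi := i1 hrk
        have ht'e : t' ≤ e := by
          rcases hi with hi | ⟨j, -, -, hi⟩
          · exact hle _ (hpos _) hi
          · exact hle _ (hpos' _) hi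
        rcases lt_trichotomy ((m + 2) * t) e with hlt | heq | hgt
        · rw [s1 hlt] at hi
          rcases hi with hi | ⟨j, hj1, hj2, hi⟩
          · left
            rw [show k + 1 + 1 - r = (k + 1 - r) + 1 by omega, pow_succ', ← hi]
            ring
          · right
            refine ⟨j + 1, by omega, by omega, ?_⟩
            rw [pow_succ', ← hi]
            ring
        -- No tie is possible here: it would give t' ≥ p t = e + t > e.
        · have := s3 heq
          omega
        · have := s2 hgt
          omega
      · obtain rfl : r = k + 2 := by omega
        have hi := i2 (by omega)
        rw [show k + 2 - k = 2 by omega] at hi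
        rcases lt_trichotomy ((m + 2) * t) e with hlt | heq | hgt
        · rw [s1 hlt] at hi
          rcases hi with hi | ⟨j, hj, hi⟩
          · have : (m + 3) * t ≤ 2 * ((m + 2) * t) := by rw [hmt, hmt']; omega
            omega
          · right
            refine ⟨j + 1, by omega, by omega, ?_⟩
            rw [pow_succ', ← hi]
            ring
        · right
          exact ⟨0, by omega, by omega, by rw [pow_zero, mul_one, mul_comm]; exact heq⟩
        · have := s2 hgt
          rcases hi with hi | ⟨j, hj, hi⟩
          · left
            simp
            omega
          · have := hle _ (hpos' _) hi
            omega
    · have hi := i2 (by omega)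
      rcases lt_trichotomy ((m + 2) * t) e with hlt | heq | hgt
      · rw [s1 hlt] at hi
        rcases hi with hi | ⟨j, hj, hi⟩
        · have h1 : (m + 3) * t ≤ 2 * ((m + 2) * t) := by rw [hmt, hmt']; omega
          have h2 : 2 * e ≤ (r - k) * e := Nat.mul_le_mul_right _ (by omega)
          omega
        · right
          refine ⟨j + 1, by omega, ?_⟩
          rw [pow_succ', ← hi]
          ring
      · right
        exact ⟨0, by omega, by rw [pow_zero, mul_one, mul_comm]; exact heq⟩
      · have h1 := s2 hgt
        rcases hi with hi | ⟨j, hj, hi⟩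
        · left
          have : (r - k) * e = (r - (k + 1)) * e + e := by
            rw [show r - k = (r - (k + 1)) + 1 by omega]; ring
          omega
        · have := hle _ (hpos' _) hi
          omega

end Valuation

/-! ### Valuations at primes of a Dedekind domain. -/

section IdealValuation

variable {R : Type*} [CommRing R] [IsDedekindDomain R]

/-- The additive valuation attached to a nonzero prime ideal of a Dedekind domain. -/
noncomputable def Ideal.primeAddVal (P : Ideal R) (hP : Prime P) : AddValuation R ℕ∞ :=
  AddValuation.of (fun x => emultiplicity P (Ideal.span {x}))
    (by simp)
    (by
      rw [Ideal.span_singleton_one, emultiplicity_eq_zero, ← Ideal.one_eq_top,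
        ← isUnit_iff_dvd_one]
      exact hP.not_isUnit)
    (fun x y => by
      refine ENat.forall_natCast_le_iff_le.1 fun n hn => ?_
      rw [le_min_iff] at hn
      rw [← pow_dvd_iff_le_emultiplicity, ← pow_dvd_iff_le_emultiplicity,
        Ideal.dvd_span_singleton, Ideal.dvd_span_singleton] at hn
      rw [← pow_dvd_iff_le_emultiplicity, Ideal.dvd_span_singleton]
      exact add_mem hn.1 hn.2)
    (fun x y => by
      rw [← Ideal.span_singleton_mul_span_singleton, emultiplicity_mul hP])

theorem Ideal.primeAddVal_apply (P : Ideal R) (hP : Prime P) (x : R) :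
    P.primeAddVal hP x = emultiplicity P (Ideal.span {x}) := rfl

theorem Ideal.le_primeAddVal_iff (P : Ideal R) (hP : Prime P) (x : R) (n : ℕ) :
    n ≤ P.primeAddVal hP x ↔ x ∈ P ^ n := by
  rw [primeAddVal_apply, ← pow_dvd_iff_le_emultiplicity, Ideal.dvd_span_singleton]

theorem Ideal.primeAddVal_pos_iff (P : Ideal R) (hP : Prime P) (x : R) :
    0 < P.primeAddVal hP x ↔ x ∈ P := by
  have h := P.le_primeAddVal_iff hP x 1
  rwa [pow_one, Nat.cast_one, Order.one_le_iff_pos] at h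

theorem Ideal.primeAddVal_eq_zero_iff (P : Ideal R) (hP : Prime P) (x : R) :
    P.primeAddVal hP x = 0 ↔ x ∉ P := by
  rw [← P.primeAddVal_pos_iff hP, pos_iff_ne_zero, not_not]

theorem Ideal.primeAddVal_eq_multiplicity (P : Ideal R) (hP : Prime P) {x : R} (hx : x ≠ 0) :
    P.primeAddVal hP x = multiplicity P (Ideal.span {x}) := by
  rw [primeAddVal_apply]
  refine (FiniteMultiplicity.of_prime_left hP ?_).emultiplicity_eq_multiplicity
  simpa using hx

end IdealValuation

/-! ### Norms, local contributions and resultants. -/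

section Norms

open NumberField

variable {K : Type*} [Field K] [NumberField K]

variable (K) in
open Classical in
/-- The primes of `K` above `p`. -/
noncomputable def primesAbove (p : ℕ) : Finset (Ideal (𝓞 K)) :=
  (UniqueFactorizationMonoid.normalizedFactors (Ideal.span {(p : 𝓞 K)})).toFinset

variable {p : ℕ} [hp : Fact p.Prime]

theorem mem_primesAbove {P : Ideal (𝓞 K)} :
    P ∈ primesAbove K p ↔ P.IsPrime ∧ (p : 𝓞 K) ∈ P := by
  have h0 : (p : 𝓞 K) ≠ 0 := Nat.cast_ne_zero.2 hp.out.ne_zero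
  rw [primesAbove, Multiset.mem_toFinset, Ideal.mem_normalizedFactors_iff (by simpa using h0),
    Ideal.span_singleton_le_iff_mem]

theorem prime_of_mem_primesAbove {P : Ideal (𝓞 K)} (h : P ∈ primesAbove K p) : Prime P := by
  obtain ⟨h1, h2⟩ := mem_primesAbove.1 h
  refine Ideal.prime_of_isPrime ?_ h1
  rintro rfl
  exact (Nat.cast_ne_zero.2 hp.out.ne_zero : (p : 𝓞 K) ≠ 0) (by simpa using h2)

theorem isMaximal_of_mem_primesAbove {P : Ideal (𝓞 K)} (h : P ∈ primesAbove K p) :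
    P.IsMaximal :=
  (mem_primesAbove.1 h).1.isMaximal (prime_of_mem_primesAbove h).ne_zero

/-- The residue degree over `p` of a prime `P`. -/
noncomputable def residueDegree (p : ℕ) (P : Ideal (𝓞 K)) : ℕ := Nat.log p (Ideal.absNorm P)

theorem absNorm_eq_pow_residueDegree {P : Ideal (𝓞 K)} (h : P ∈ primesAbove K p) :
    Ideal.absNorm P = p ^ residueDegree p P := by
  have hmax := isMaximal_of_mem_primesAbove h
  obtain ⟨q, n, hn, hqP, hq, hN⟩ := Ideal.exists_prime_and_absNorm_eq_pow P
  obtain rfl : p = q := by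
    by_contra hne
    have hcop : IsCoprime (p : ℤ) (q : ℤ) :=
      Nat.isCoprime_iff_coprime.2 ((Nat.coprime_primes hp.out hq).2 hne)
    obtain ⟨a, b, hab⟩ := hcop
    have h1 : ((a * p + b * q : ℤ) : 𝓞 K) ∈ P := by
      push_cast
      exact add_mem (P.mul_mem_left _ (mem_primesAbove.1 h).2) (P.mul_mem_left _ hqP)
    rw [hab, Int.cast_one] at h1
    exact hmax.ne_top ((Ideal.eq_top_iff_one _).2 h1)
  rw [residueDegree, hN, Nat.log_pow hp.out.one_lt]

/-- The `p`-part of the norm of `x` is the product of the local contributions. -/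
theorem exists_absNorm_span_eq {x : 𝓞 K} (hx : x ≠ 0) :
    ∃ c : ℕ, ¬ p ∣ c ∧ Ideal.absNorm (Ideal.span {x}) =
      p ^ (∑ P ∈ primesAbove K p, residueDegree p P * multiplicity P (Ideal.span {x})) * c := by
  have hx' : Ideal.span {x} ≠ ⊥ := by simpa using hx
  have hdvd : ∏ P ∈ primesAbove K p, P ^ multiplicity P (Ideal.span {x}) ∣ Ideal.span {x} := by
    refine Finset.prod_dvd_of_coprime (fun P hP Q hQ hPQ => ?_)
      fun P _ => pow_multiplicity_dvd _ _
    have := isMaximal_of_mem_primesAbove hP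
    have := isMaximal_of_mem_primesAbove hQ
    exact (Ideal.isCoprime_of_isMaximal hPQ).pow
  obtain ⟨J, hJ⟩ := hdvd
  refine ⟨Ideal.absNorm J, fun hpJ => ?_, ?_⟩
  · obtain ⟨P, hPmax, hPu, hPJ⟩ := Ideal.exists_isMaximal_dvd_of_dvd_absNorm' hp.out J hpJ
    have hpP : (p : 𝓞 K) ∈ P := by
      have : (p : ℤ) ∈ P.under ℤ := by rw [hPu]; exact Ideal.mem_span_singleton_self _
      simpa [Ideal.mem_comap] using this
    have hP : P ∈ primesAbove K p := mem_primesAbove.2 ⟨hPmax.isPrime, hpP⟩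
    have h1 : P ^ (multiplicity P (Ideal.span {x}) + 1) ∣ Ideal.span {x} := by
      conv_rhs => rw [hJ]
      rw [pow_succ]
      exact mul_dvd_mul (Finset.dvd_prod_of_mem
        (fun P => P ^ multiplicity P (Ideal.span {x})) hP) hPJ
    exact (FiniteMultiplicity.of_prime_left (prime_of_mem_primesAbove hP)
      hx').not_pow_dvd_of_multiplicity_lt (Nat.lt_succ_self _) h1
  · conv_lhs => rw [hJ]
    rw [map_mul, map_prod, ← Finset.prod_pow_eq_pow_sum]
    congr 1
    refine Finset.prod_congr rfl fun P hP => ?_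
    rw [map_pow, absNorm_eq_pow_residueDegree hP, ← pow_mul]

/-- Reads a sum over the primes above `p` off a norm whose power of `p` is known; it also shows that
the element is nonzero. -/
theorem sum_residueDegree_mul_multiplicity {x : 𝓞 K} {A c : ℕ} (hc : ¬ p ∣ c)
    (h : Ideal.absNorm (Ideal.span {x}) = p ^ A * c) :
    x ≠ 0 ∧
      ∑ P ∈ primesAbove K p, residueDegree p P * multiplicity P (Ideal.span {x}) = A := by
  have hx : x ≠ 0 := by
    rintro rfl
    have h0 : p ^ A * c = 0 := by rw [← h]; simp
    rcases Nat.mul_eq_zero.1 h0 with h0 | h0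
    · exact absurd h0 (pow_ne_zero _ hp.out.ne_zero)
    · exact hc (h0 ▸ dvd_zero _)
  refine ⟨hx, ?_⟩
  obtain ⟨c', hc', h'⟩ := exists_absNorm_span_eq (p := p) hx
  rw [h] at h'
  have key : ∀ B d, ¬ p ∣ d → (p ^ B * d).factorization p = B := fun B d hd => by
    have hd0 : d ≠ 0 := fun h => hd (h ▸ dvd_zero _)
    rw [Nat.factorization_mul (pow_ne_zero _ hp.out.ne_zero) hd0, hp.out.factorization_pow]
    simp [Nat.factorization_eq_zero_of_not_dvd hd]
  have e := congrArg (fun z => z.factorization p) h'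
  simp only [key _ _ hc, key _ _ hc'] at e
  exact e.symm

/-- The norm of a polynomial in a generator is a resultant. -/
theorem absNorm_span_aeval {F : ℤ[X]} (hF : F.Monic) (hirr : Irreducible F) {θ : 𝓞 K}
    (hroot : aeval θ F = 0) (hgen : IntermediateField.adjoin ℚ {(θ : K)} = ⊤) (H : ℤ[X]) :
    Ideal.absNorm (Ideal.span {aeval θ H}) = (resultant F H).natAbs := by
  classical
  rw [Ideal.absNorm_span_singleton]
  congr 1
  have hint : IsIntegral ℚ (θ : K) := Algebra.IsIntegral.isIntegral _
  let pb : PowerBasis ℚ K := (IntermediateField.adjoin.powerBasis hint).map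
    ((IntermediateField.equivOfEq hgen).trans IntermediateField.topEquiv)
  have hpb : pb.gen = (θ : K) := by simp [pb]
  have hrootK : aeval (θ : K) F = 0 := by
    have := congrArg (algebraMap (𝓞 K) K) hroot
    rwa [map_zero, ← aeval_algebraMap_apply] at this
  have hmin : minpoly ℚ pb.gen = F.map (algebraMap ℤ ℚ) := by
    rw [hpb]
    symm
    refine minpoly.eq_of_irreducible_of_monic
      ((Monic.irreducible_iff_irreducible_map_fraction_map hF).1 hirr) ?_ (hF.map _)
    rwa [aeval_map_algebraMap]
  let E := AlgebraicClosure ℚ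
  have hinj : Function.Injective (algebraMap ℤ E) := (algebraMap ℤ E).injective_int
  apply hinj
  have hsep : IsSeparable ℚ pb.gen := Algebra.IsSeparable.isSeparable ℚ _
  have hmap : (minpoly ℚ pb.gen).map (algebraMap ℚ E) = F.map (algebraMap ℤ E) := by
    rw [hmin, Polynomial.map_map, ← IsScalarTower.algebraMap_eq]
  have hsplit : (F.map (algebraMap ℤ E)).Splits := IsAlgClosed.splits _
  rw [hF.resultant_map, resultant_eq_prod_eval _ _ _ le_rfl hsplit, (hF.map _).leadingCoeff,
    one_pow, one_mul]
  have h1 : algebraMap ℤ E (Algebra.norm ℤ (aeval θ H)) =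
      algebraMap ℚ E (Algebra.norm ℚ (aeval (θ : K) H)) := by
    have : ((aeval θ H : 𝓞 K) : K) = aeval (θ : K) H := (aeval_algebraMap_apply K θ H).symm
    rw [← this, ← Algebra.coe_norm_int]
    simp
  -- Embeddings of K correspond to roots of F, so the norm is the product of the values of H at
  -- these roots, as is the resultant.
  rw [h1, Algebra.norm_eq_prod_embeddings]
  rw [@Fintype.prod_equiv (K →ₐ[ℚ] E) _ _ _ _ _ pb.liftEquiv'
    (fun σ => σ (aeval (θ : K) H)) (fun x => aeval (x : E) H) ?_]
  · rw [Finset.prod_mem_multiset _ _ (fun x => aeval (x : E) H) (fun _ => rfl), Finset.prod_eq_multiset_prod, Multiset.toFinset_val,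
      Multiset.dedup_eq_self.mpr]
    · rw [aroots_def, hmap]
      simp [eval_map_algebraMap]
    · exact nodup_roots (.map hsep)
  · intro σ
    rw [PowerBasis.liftEquiv'_apply_coe, hpb]
    exact (aeval_algHom_apply (σ.restrictScalars ℤ) (θ : K) H).symm

end Norms

/-! ### Residue fields and common index divisors. -/

section Residue

open NumberField

variable {K : Type*} [Field K] [NumberField K] {p : ℕ} [hp : Fact p.Prime]

/-- The minimal polynomial over `𝔽_p` of the residue of `η` at a prime above `p`. -/
theorem exists_residue_minpoly {P : Ideal (𝓞 K)} (hP : P ∈ primesAbove K p) (η : 𝓞 K) :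
    ∃ g : (ZMod p)[X], g.Monic ∧ Irreducible g ∧
      (∀ q : ℤ[X], aeval η q ∈ P ↔ g ∣ q.map (Int.castRingHom (ZMod p))) ∧
      g.natDegree ∣ residueDegree p P ∧
      ((∀ x, ∃ q : ℤ[X], x - aeval η q ∈ P) → g.natDegree = residueDegree p P) := by
  have hmax := isMaximal_of_mem_primesAbove hP
  let := Ideal.Quotient.field P
  have hchar : CharP (𝓞 K ⧸ P) p := by
    rw [CharP.charP_iff_prime_eq_zero hp.out, ← map_natCast (Ideal.Quotient.mk P),
      Ideal.Quotient.eq_zero_iff_mem]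
    exact (mem_primesAbove.1 hP).2
  let : Algebra (ZMod p) (𝓞 K ⧸ P) := ZMod.algebra _ p
  have hcard : Nat.card (𝓞 K ⧸ P) = p ^ residueDegree p P := by
    rw [← absNorm_eq_pow_residueDegree hP]; rfl
  have hfin : Finite (𝓞 K ⧸ P) := Nat.finite_of_card_ne_zero
    (hcard.trans_ne (pow_ne_zero _ hp.out.ne_zero))
  have hrank : Module.finrank (ZMod p) (𝓞 K ⧸ P) = residueDegree p P := by
    have h := Module.natCard_eq_pow_finrank (K := ZMod p) (V := 𝓞 K ⧸ P)
    rw [hcard, Nat.card_zmod] at h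
    exact (Nat.pow_right_injective hp.out.two_le h).symm
  set β := Ideal.Quotient.mk P η with hβ
  have hint : IsIntegral (ZMod p) β := Algebra.IsIntegral.isIntegral β
  have haeval : ∀ q : ℤ[X], aeval β (q.map (Int.castRingHom (ZMod p))) =
      Ideal.Quotient.mk P (aeval η q) := by
    intro q
    rw [aeval_def, eval₂_map, aeval_def, hom_eval₂]
    congr 1
    exact RingHom.ext_int _ _
  refine ⟨minpoly (ZMod p) β, minpoly.monic hint, minpoly.irreducible hint, fun q => ?_, ?_,
    fun h => ?_⟩
  · rw [← Ideal.Quotient.eq_zero_iff_mem, ← haeval, ← minpoly.dvd_iff]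
  · rw [← hrank]
    exact minpoly.degree_dvd hint
  · rw [← hrank, ← Field.primitive_element_iff_minpoly_natDegree_eq, eq_top_iff]
    rintro y -
    obtain ⟨x, rfl⟩ := Ideal.Quotient.mk_surjective y
    obtain ⟨q, hq⟩ := h x
    rw [(Ideal.Quotient.mk_eq_mk_iff_sub_mem _ _).2 hq, ← haeval]
    exact IntermediateField.algebra_adjoin_le_adjoin _ _ (aeval_mem_adjoin_singleton _ _)

theorem finite_setOf_natDegree_eq (p d : ℕ) [Fact p.Prime] :
    {g : (ZMod p)[X] | g.natDegree = d}.Finite := by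
  have : Finite (degreeLT (ZMod p) (d + 1)) :=
    Finite.of_equiv _ (degreeLTEquiv (ZMod p) (d + 1)).symm.toEquiv
  refine (Set.toFinite (degreeLT (ZMod p) (d + 1) : Set (ZMod p)[X])).subset ?_
  rintro g rfl
  exact mem_degreeLT.2 (degree_le_natDegree.trans_lt (by exact_mod_cast Nat.lt_succ_self _))

/-- If `p` does not divide the index of `ℤ[η]`, then `ℤ[η]` is dense modulo `p`. -/
theorem exists_sub_aeval_mem_span {η : 𝓞 K} (h : ¬ p ∣ elementIndex η) (x : 𝓞 K) :
    ∃ q : ℤ[X], x - aeval η q ∈ Ideal.span {(p : 𝓞 K)} := by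
  -- The index annihilates the quotient by ℤ[η]. An infinite index has the value 0, which `h`
  -- excludes.
  have hmem : elementIndex η • x ∈ Algebra.adjoin ℤ {η} :=
    AddSubgroup.nsmul_index_mem (Algebra.adjoin ℤ {η}).toSubmodule.toAddSubgroup x
  rw [Algebra.adjoin_singleton_eq_range_aeval] at hmem
  obtain ⟨q, hq⟩ := hmem
  obtain ⟨a, b, hab⟩ : IsCoprime (elementIndex η : ℤ) (p : ℤ) :=
    Nat.isCoprime_iff_coprime.2 ((Nat.Prime.coprime_iff_not_dvd hp.out).2 h).symm
  refine ⟨C a * q, Ideal.mem_span_singleton.2 ⟨b * x, ?_⟩⟩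
  have hab' : (a : 𝓞 K) * elementIndex η + b * p = 1 := by
    exact_mod_cast congrArg (Int.cast (R := 𝓞 K)) hab
  have hq' : aeval η q = elementIndex η • x := hq
  rw [map_mul, hq', aeval_C, nsmul_eq_mul]
  simp only [algebraMap_int_eq, eq_intCast]
  linear_combination -x * hab'

/-- More primes of residue degree `d` above `p` than irreducible polynomials of degree `d` over
`𝔽_p` force `p` to divide the index of the field. -/
theorem dvd_fieldIndex_of_numIrred_lt (d : ℕ)
    (h : numIrred p d < ((primesAbove K p).filter fun P => residueDegree p P = d).card) :
    p ∣ fieldIndex K := by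
  classical
  rw [dvd_fieldIndex_iff]
  intro η _
  by_contra hη
  refine absurd h (not_lt.2 ?_)
  have hdense := exists_sub_aeval_mem_span hη
  have hmem : ∀ P ∈ primesAbove K p, ∀ y ∈ Ideal.span {(p : 𝓞 K)}, y ∈ P := fun P hP y hy =>
    (Ideal.span_singleton_le_iff_mem P).2 (mem_primesAbove.1 hP).2 hy
  have hex : ∀ P : Ideal (𝓞 K), ∃ g : (ZMod p)[X], P ∈ primesAbove K p →
      g.Monic ∧ Irreducible g ∧
      (∀ q : ℤ[X], aeval η q ∈ P ↔ g ∣ q.map (Int.castRingHom (ZMod p))) ∧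
      g.natDegree = residueDegree p P := by
    intro P
    by_cases hP : P ∈ primesAbove K p
    · obtain ⟨g, h1, h2, h3, -, h5⟩ := exists_residue_minpoly hP η
      exact ⟨g, fun _ => ⟨h1, h2, h3, h5 fun x =>
        (hdense x).imp fun q hq => hmem P hP _ hq⟩⟩
    · exact ⟨0, fun h => absurd h hP⟩
  choose g hg using hex
  -- One polynomial in η represents x modulo all primes above `p` at once, so `g P` alone decides
  -- membership in P.
  have hle : ∀ P ∈ primesAbove K p, ∀ Q ∈ primesAbove K p, g P = g Q → P ≤ Q := by
    intro P hP Q hQ hPQ x hx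
    obtain ⟨q, hq⟩ := hdense x
    have h1 : aeval η q ∈ P := by
      have := P.sub_mem hx (hmem P hP _ hq)
      rwa [sub_sub_cancel] at this
    have h2 : aeval η q ∈ Q := ((hg Q hQ).2.2.1 q).2 (hPQ ▸ ((hg P hP).2.2.1 q).1 h1)
    have := Q.add_mem (hmem Q hQ _ hq) h2
    rwa [sub_add_cancel] at this
  rw [← Finset.card_image_of_injOn (f := g), ← Set.ncard_coe_finset]
  · refine Set.ncard_le_ncard ?_ ((finite_setOf_natDegree_eq p d).subset fun g hg => hg.2.2)
    intro f hf
    obtain ⟨P, hP, rfl⟩ := Finset.mem_image.1 hf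
    obtain ⟨hP, hPd⟩ := Finset.mem_filter.1 hP
    obtain ⟨h1, h2, -, h4⟩ := hg P hP
    exact ⟨h1, h2, h4.trans hPd⟩
  · intro P hP Q hQ hPQ
    have hP' := (Finset.mem_filter.1 hP).1
    have hQ' := (Finset.mem_filter.1 hQ).1
    exact le_antisymm (hle P hP' Q hQ' hPQ) (hle Q hQ' P hP' hPQ.symm)

theorem not_fieldIsMonogenic_of_dvd {q : ℕ} (hq1 : q ≠ 1) (h : q ∣ fieldIndex K) :
    ¬ FieldIsMonogenic K := by
  rintro ⟨η, hη⟩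
  have hgen : IntermediateField.adjoin ℚ {(η : K)} = ⊤ := by
    have hmem : ∀ y : 𝓞 K, (y : K) ∈ IntermediateField.adjoin ℚ {(η : K)} := by
      intro y
      have hy : y ∈ Algebra.adjoin ℤ {η} := hη ▸ Algebra.mem_top
      rw [Algebra.adjoin_singleton_eq_range_aeval] at hy
      obtain ⟨f, hf⟩ := hy
      have : (y : K) = aeval (η : K) (f.map (algebraMap ℤ ℚ)) := by
        rw [aeval_map_algebraMap, ← show aeval η f = y from hf]
        exact (aeval_algebraMap_apply K η f).symm
      rw [this]
      exact IntermediateField.algebra_adjoin_le_adjoin _ _ (aeval_mem_adjoin_singleton _ _)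
    rw [eq_top_iff]
    rintro x -
    obtain ⟨a, b, -, rfl⟩ := IsFractionRing.div_surjective (A := 𝓞 K) x
    exact div_mem (hmem a) (hmem b)
  have h1 := (dvd_fieldIndex_iff K q).1 h η hgen
  rw [elementIndex, hη] at h1
  simp at h1
  exact hq1 h1

end Residue

/-! ### Lifting a factor of x^u + a. -/

section TrinomialFactor

variable {p : ℕ} [hp : Fact p.Prime]

theorem map_C_intCast (c : ℤ) :
    (C c).map (Int.castRingHom (ZMod p)) = C (c : ZMod p) := by
  rw [map_C]; rfl

/-- Since `p` does not divide `u`, the binomial is separable. -/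
theorem isCoprime_factor_of_X_pow_add_C {u : ℕ} (hu : ¬ p ∣ u) {c : ZMod p} (hc : c ≠ 0)
    {g h : (ZMod p)[X]} (hgh : X ^ u + C c = g * h) : IsCoprime g h := by
  have hsep : (X ^ u - C (-c)).Separable :=
    separable_X_pow_sub_C _ (by rwa [Ne, CharP.cast_eq_zero_iff (ZMod p) p]) (neg_ne_zero.2 hc)
  rw [map_neg, sub_neg_eq_add, hgh] at hsep
  exact hsep.isCoprime

theorem not_dvd_C_of_irreducible {g : (ZMod p)[X]} (hg : Irreducible g) {c : ZMod p}
    (hc : c ≠ 0) : ¬ g ∣ C c := fun h =>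
  hg.not_isUnit (isUnit_of_dvd_unit h (isUnit_C.2 hc.isUnit))

theorem not_dvd_X_of_dvd_X_pow_add_C {u : ℕ} (hu : u ≠ 0) {c : ZMod p} (hc : c ≠ 0)
    {g : (ZMod p)[X]} (hg : Irreducible g) (hgu : g ∣ X ^ u + C c) : ¬ g ∣ X := fun h =>
  not_dvd_C_of_irreducible hg hc ((dvd_add_right (dvd_pow h hu)).1 hgu)

/-- The lift `φ` of an irreducible factor `g` of `x ^ u + a` modulo `p` to an approximate factor
of `x ^ u + a'`, together with the powers of `p` in two resultants. -/
theorem exists_lift_of_trinomial (hodd : Odd p) {m u k r : ℕ} {a a' b : ℤ}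
    (hpa : ¬ (p : ℤ) ∣ a) (hpb : (p : ℤ) ∣ b) (hpu : ¬ p ∣ u) (haa' : (a' : ZMod p) = a)
    {g : (ZMod p)[X]} (hg : g.Monic) (hirr : Irreducible g) (hgu : g ∣ X ^ u + C (a : ZMod p))
    {h : ℤ[X]} (hh : C (a' ^ p ^ k - a) * X ^ m - C b = C ((p : ℤ) ^ r) * h)
    (hgh : ¬ g ∣ h.map (Int.castRingHom (ZMod p))) :
    ∃ φ ψ E : ℤ[X], φ.natDegree = g.natDegree ∧
      φ.map (Int.castRingHom (ZMod p)) = g ∧ ¬ g ∣ ψ.map (Int.castRingHom (ZMod p)) ∧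
      X ^ u + C a' = φ * ψ + C ((p : ℤ) ^ (r + 1)) * E ∧
      (∃ c : ℕ, ¬ p ∣ c ∧
        (resultant (X ^ (m + u * p ^ k) + C a * X ^ m + C b) φ).natAbs =
          p ^ (r * g.natDegree) * c) ∧
      ∀ M, p ^ k < M → ∃ c : ℕ, ¬ p ∣ c ∧
        (resultant (X ^ (m + u * p ^ k) + C a * X ^ m + C b) (φ ^ M + C (p : ℤ))).natAbs =
          p ^ (p ^ k * g.natDegree) * c := by
  have ha0 : (a : ZMod p) ≠ 0 := by rwa [Ne, ZMod.intCast_zmod_eq_zero_iff_dvd]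
  have hb0 : (b : ZMod p) = 0 := by rwa [ZMod.intCast_zmod_eq_zero_iff_dvd]
  obtain ⟨h0, hh0⟩ := hgu
  have hcop := isCoprime_factor_of_X_pow_add_C hpu ha0 hh0
  have hgX : IsCoprime g X := (Irreducible.coprime_iff_not_dvd hirr).2
    (not_dvd_X_of_dvd_X_pow_add_C (fun h => hpu (by rw [h]; exact dvd_zero p)) ha0 hirr ⟨h0, hh0⟩)
  obtain ⟨φ, ψ, E, hφm, hφd, hφ, hψ, hE⟩ := exists_monic_lift_factor (X ^ u + C a') hg hcop
    (by rw [Polynomial.map_add, Polynomial.map_pow, map_X, map_C_intCast, haa', hh0]) (r + 1) (Nat.succ_pos r)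
  refine ⟨φ, ψ, E, hφd, hφ, ?_, hE, ?_, fun M hM => ?_⟩
  · rw [hψ]
    exact (Irreducible.coprime_iff_not_dvd hirr).1 hcop
  -- Modulo φ and p^(r+1), X^u is -a', so F is -((a'^(p^k) - a) X^m - b) = -p^r h.
  · obtain ⟨W, hW⟩ := sub_dvd_pow_sub_pow (X ^ u : ℤ[X]) (-C a') (p ^ k)
    rw [hodd.pow.neg_pow, sub_neg_eq_add, sub_neg_eq_add, hE] at hW
    obtain ⟨c, hc, hres⟩ := natAbs_resultant_eq_pow_mul (p := p)
      (F := X ^ (m + u * p ^ k) + C a * X ^ m + C b) (G := C (p : ℤ) * X ^ m * W * E - h)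
      (Q := X ^ m * W * ψ) hφm r (by
        rw [pow_add, pow_mul]
        simp only [C_sub, C_pow, C_mul, pow_succ] at hh hW ⊢
        linear_combination X ^ m * hW - hh) (by
        rw [hφ]
        simp only [Polynomial.map_sub, Polynomial.map_mul, Polynomial.map_C]
        simp only [map_natCast, CharP.cast_eq_zero, map_zero, zero_mul, zero_sub]
        exact ((Irreducible.coprime_iff_not_dvd hirr).2 hgh).neg_right)
    exact ⟨c, hc, by rw [hres, hφd]⟩
  · obtain ⟨F₂, hF₂⟩ := exists_eq_C_mul_of_map_eq_zero (p := p)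
      (q := X ^ (m + u * p ^ k) + C a * X ^ m + C b - φ ^ p ^ k * (X ^ m * ψ ^ p ^ k)) (by
        -- Frobenius fixes the coefficient in 𝔽_p, so φ occurs in F modulo `p` with exponent p^k.
        have hfrob : (X ^ u + C (a : ZMod p)) ^ p ^ k = X ^ (u * p ^ k) + C (a : ZMod p) := by
          rw [add_pow_char_pow, ← C_pow, ZMod.pow_card_pow, pow_mul]
        rw [hh0, mul_pow] at hfrob
        simp only [Polynomial.map_sub, Polynomial.map_add, Polynomial.map_mul,
          Polynomial.map_pow, map_C_intCast, map_X, hφ, hψ, hb0, pow_add]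
        rw [map_zero]
        linear_combination -X ^ m * hfrob)
    obtain ⟨c, hc, hres⟩ := natAbs_resultant_pow_add (p := p)
      (F := X ^ (m + u * p ^ k) + C a * X ^ m + C b) hφm (by rw [hφd]; exact hirr.natDegree_pos)
      (p ^ k) M hM (by rw [← hF₂, add_sub_cancel]) (by
        rw [hφ]
        simp only [Polynomial.map_mul, Polynomial.map_pow, map_X, hψ]
        exact hgX.pow_right.mul_right hcop.pow_right)
    exact ⟨c, hc, by rw [hres, hφd]⟩

end TrinomialFactor

/-! ### The possible ratios e/t at a prime over g. -/

section Local

open NumberField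

variable {K : Type*} [Field K] [NumberField K] {p : ℕ} [hp : Fact p.Prime]

/-- At a prime over the factor `g`, the valuation of `p` is that of `φ(θ)` times one of the
lengths `p ^ (k + 1 - r)` and `(p - 1) p ^ j` with `k + 1 - r ≤ j < k`. -/
theorem multiplicity_of_trinomial_root (hodd : Odd p) {m u k r : ℕ} (hr : 1 ≤ r) (hrk : r ≤ k + 1)
    {a a' b : ℤ} (hpa : ¬ (p : ℤ) ∣ a) (hpu : ¬ p ∣ u) (haa' : (a' : ZMod p) = a) {θ : 𝓞 K}
    (hroot : aeval θ (X ^ (m + u * p ^ k) + C a * X ^ m + C b : ℤ[X]) = 0)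
    {g : (ZMod p)[X]} (hirr : Irreducible g) (hgu : g ∣ X ^ u + C (a : ZMod p))
    {h φ ψ E : ℤ[X]} (hh : C (a' ^ p ^ k - a) * X ^ m - C b = C ((p : ℤ) ^ r) * h)
    (hgh : ¬ g ∣ h.map (Int.castRingHom (ZMod p)))
    (hψ : ¬ g ∣ ψ.map (Int.castRingHom (ZMod p)))
    (hE : X ^ u + C a' = φ * ψ + C ((p : ℤ) ^ (r + 1)) * E)
    {P : Ideal (𝓞 K)} (hP : P ∈ primesAbove K p)
    (hgP : ∀ q : ℤ[X], aeval θ q ∈ P ↔ g ∣ q.map (Int.castRingHom (ZMod p)))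
    (hφ0 : aeval θ φ ≠ 0) :
    ∃ len, multiplicity P (Ideal.span {(p : 𝓞 K)}) =
        multiplicity P (Ideal.span {aeval θ φ}) * len ∧
      (len = p ^ (k + 1 - r) ∨ ∃ j < r - 1, len = p ^ (k + 1 - r) * ((p - 1) * p ^ j)) := by
  have ha0 : (a : ZMod p) ≠ 0 := by rwa [Ne, ZMod.intCast_zmod_eq_zero_iff_dvd]
  have hPp := prime_of_mem_primesAbove hP
  have hp0 : (p : 𝓞 K) ≠ 0 := Nat.cast_ne_zero.2 hp.out.ne_zero
  have hp3 : 3 ≤ p := by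
    have := hp.out.two_le
    obtain ⟨j, hj⟩ := hodd
    omega
  set v := P.primeAddVal hPp with hv
  set e := multiplicity P (Ideal.span {(p : 𝓞 K)})
  set t := multiplicity P (Ideal.span {aeval θ φ})
  have hve : v (p : 𝓞 K) = e := P.primeAddVal_eq_multiplicity hPp hp0
  have hvt : v (aeval θ φ) = t := P.primeAddVal_eq_multiplicity hPp hφ0
  have he0 : 0 < e := by
    have : 0 < v (p : 𝓞 K) := (P.primeAddVal_pos_iff hPp _).2 (mem_primesAbove.1 hP).2
    rw [hve] at this
    exact_mod_cast this
  have hunit : ∀ q : ℤ[X], ¬ g ∣ q.map (Int.castRingHom (ZMod p)) → v (aeval θ q) = 0 :=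
    fun q hq => (P.primeAddVal_eq_zero_iff hPp _).2 fun h => hq ((hgP q).1 h)
  have haC : ∀ c : ℤ, aeval θ (C c) = (c : 𝓞 K) := fun c => by simp
  have hvα : v (-(a' : 𝓞 K)) = 0 := by
    rw [v.map_neg]
    have := hunit (C a') (by
      rw [map_C_intCast, haa']
      exact not_dvd_C_of_irreducible hirr ha0)
    rwa [haC] at this
  have hvθ : v θ = 0 := by
    have := hunit X (by
      simpa using not_dvd_X_of_dvd_X_pow_add_C (fun h => hpu (by rw [h]; exact dvd_zero p)) ha0 hirr hgu)
    simpa using this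
  have hvp : ∀ i, v ((p : 𝓞 K) ^ i) = (i * e : ℕ) := fun i => by
    rw [v.map_pow, hve, nsmul_eq_mul]; push_cast; rfl
  -- F(θ) = 0 turns this difference, up to the unit θ^m, into p^r h(θ), and h(θ) is a unit at P.
  have hval : v ((θ ^ u) ^ p ^ k - (-(a' : 𝓞 K)) ^ p ^ k) = (r * e : ℕ) := by
    have h1 := congrArg (aeval θ) hh
    simp only [map_sub, map_mul, map_pow, map_add, aeval_X, haC, Int.cast_natCast] at h1 hroot
    have h2 : θ ^ m * ((θ ^ u) ^ p ^ k - (-(a' : 𝓞 K)) ^ p ^ k) = (p : 𝓞 K) ^ r * aeval θ h := by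
      rw [hodd.pow.neg_pow, ← pow_mul]
      rw [pow_add] at hroot
      linear_combination hroot + h1
    have h3 := congrArg v h2
    rwa [v.map_mul, v.map_mul, v.map_pow, hvθ, smul_zero, zero_add, hvp, hunit h hgh,
      add_zero] at h3
  obtain ⟨T, hT⟩ : ∃ T : ℕ, v (θ ^ u - -(a' : 𝓞 K)) = T := by
    obtain ⟨c, hc⟩ := sub_dvd_pow_sub_pow (θ ^ u) (-(a' : 𝓞 K)) (p ^ k)
    have hle : v (θ ^ u - -(a' : 𝓞 K)) ≤ (r * e : ℕ) := by
      rw [← hval, hc, v.map_mul]; exact le_self_add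
    exact ⟨_, (ENat.natCast_toNat (ne_top_of_le_ne_top (ENat.natCast_ne_top _) hle)).symm⟩
  have hT0 : 0 < T := by
    have h1 : aeval θ (X ^ u + C a') ∈ P := (hgP _).2 (by
      rwa [Polynomial.map_add, Polynomial.map_pow, map_X, map_C_intCast, haa'])
    have h2 := (P.primeAddVal_pos_iff hPp _).2 h1
    rw [show aeval θ (X ^ u + C a') = θ ^ u - -(a' : 𝓞 K) by simp, ← hv, hT] at h2
    exact_mod_cast h2
  have hslope := (v.map_sub_of_map_pow_sub hp.out hp3 hve he0 k _ _ T r hvα hT hT0 hr hval).1 hrk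
  have hTe : T ≤ e := by
    rcases hslope with hs | ⟨j, -, -, hs⟩
    · exact hs ▸ Nat.le_mul_of_pos_right T (by positivity)
    · exact hs ▸ Nat.le_mul_of_pos_right T (Nat.mul_pos (by omega) (by positivity))
  -- The precision p^(r+1) suffices: the error has valuation at least (r + 1) e > e ≥ T.
  have htT : t = T := by
    have h1 := congrArg (aeval θ) hE
    simp only [map_mul, map_pow, map_add, aeval_X, haC, Int.cast_natCast] at h1
    have h2 : aeval θ φ * aeval θ ψ =
        (θ ^ u - -(a' : 𝓞 K)) - (p : 𝓞 K) ^ (r + 1) * aeval θ E := by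
      linear_combination -h1
    have h3 := congrArg v h2
    rw [v.map_mul, hvt, hunit ψ hψ, add_zero, v.map_sub_eq_of_lt_left, hT] at h3
    · exact_mod_cast h3
    · rw [hT, v.map_mul, hvp]
      refine lt_of_lt_of_le ?_ le_self_add
      have : 2 * e ≤ (r + 1) * e := Nat.mul_le_mul_right _ (by omega)
      exact_mod_cast (by omega : T < (r + 1) * e)
  rw [htT]
  rcases hslope with hs | ⟨j, hj1, hj2, hs⟩
  · exact ⟨_, hs.symm, Or.inl rfl⟩
  · refine ⟨_, hs.symm, Or.inr ⟨j - (k + 1 - r), by omega, ?_⟩⟩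
    rw [mul_left_comm, ← pow_add, Nat.add_sub_cancel' hj1]

end Local

/-! ### Counting the primes over a factor. -/

section Counting

open NumberField

variable {K : Type*} [Field K] [NumberField K] {p : ℕ} [hp : Fact p.Prime]

variable (p) in
open Classical in
/-- The primes above `p` of residue degree `deg g` at which the residue of `θ` is a root of the
irreducible polynomial `g`. -/
noncomputable def primesOverFactor (θ : 𝓞 K) (g : (ZMod p)[X]) : Finset (Ideal (𝓞 K)) :=
  (primesAbove K p).filter fun P => residueDegree p P = g.natDegree ∧
    ∀ q : ℤ[X], aeval θ q ∈ P ↔ g ∣ q.map (Int.castRingHom (ZMod p))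

/-- A prime containing a lift of the irreducible polynomial `g` has `g` as the minimal polynomial
of the residue of `θ`. -/
theorem mem_iff_dvd_of_aeval_mem {P : Ideal (𝓞 K)} (hP : P ∈ primesAbove K p) {θ : 𝓞 K}
    {g : (ZMod p)[X]} (hg : g.Monic) (hirr : Irreducible g) {φ : ℤ[X]}
    (hφ : φ.map (Int.castRingHom (ZMod p)) = g) (h : aeval θ φ ∈ P) :
    (∀ q : ℤ[X], aeval θ q ∈ P ↔ g ∣ q.map (Int.castRingHom (ZMod p))) ∧
      g.natDegree ∣ residueDegree p P := by
  obtain ⟨f, hf, hfirr, hfP, hfd, -⟩ := exists_residue_minpoly hP θ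
  obtain rfl : f = g := eq_of_monic_of_associated hf hg
    (hfirr.associated_of_dvd hirr (hφ ▸ (hfP φ).1 h))
  exact ⟨hfP, hfd⟩

theorem multiplicity_eq_zero_of_notMem {P : Ideal (𝓞 K)} {x : 𝓞 K} (h : x ∉ P) :
    multiplicity P (Ideal.span {x}) = 0 := by
  rw [multiplicity_eq_zero, Ideal.dvd_span_singleton]
  exact h

/-- If the trinomial is `p ^ r` times a unit at the roots of a suitable lift of the factor `g` of
`x ^ u + a`, then at least `r` primes of residue degree `deg g` lie over `g`. -/
theorem le_card_primesOverFactor (hodd : Odd p) {m u k r : ℕ} (hr : 1 ≤ r) (hrk : r ≤ k + 1)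
    {a a' b : ℤ} (hpa : ¬ (p : ℤ) ∣ a) (hpb : (p : ℤ) ∣ b) (hpu : ¬ p ∣ u)
    (haa' : (a' : ZMod p) = a) {θ : 𝓞 K}
    (hm : (X ^ (m + u * p ^ k) + C a * X ^ m + C b : ℤ[X]).Monic)
    (hF : Irreducible (X ^ (m + u * p ^ k) + C a * X ^ m + C b : ℤ[X]))
    (hroot : aeval θ (X ^ (m + u * p ^ k) + C a * X ^ m + C b : ℤ[X]) = 0)
    (hgen : IntermediateField.adjoin ℚ {(θ : K)} = ⊤)
    {g : (ZMod p)[X]} (hg : g.Monic) (hirr : Irreducible g) (hgu : g ∣ X ^ u + C (a : ZMod p))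
    {h : ℤ[X]} (hh : C (a' ^ p ^ k - a) * X ^ m - C b = C ((p : ℤ) ^ r) * h)
    (hgh : ¬ g ∣ h.map (Int.castRingHom (ZMod p))) :
    r ≤ (primesOverFactor p θ g).card := by
  classical
  obtain ⟨φ, ψ, E, hφd, hφ, hψ, hE, ⟨c, hc, hres⟩, hres'⟩ :=
    exists_lift_of_trinomial hodd hpa hpb hpu haa' hg hirr hgu hh hgh
  rw [← absNorm_span_aeval hm hF hroot hgen] at hres
  obtain ⟨hφ0, hsum⟩ := sum_residueDegree_mul_multiplicity hc hres
  set e : Ideal (𝓞 K) → ℕ := fun P => multiplicity P (Ideal.span {(p : 𝓞 K)})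
  set t : Ideal (𝓞 K) → ℕ := fun P => multiplicity P (Ideal.span {aeval θ φ}) with ht
  set S := (primesAbove K p).filter fun P => aeval θ φ ∈ P
  -- M exceeds p^k and every e_P, so φ(θ)^M + p has the valuation of `p` at the primes containing
  -- φ(θ), and is a unit at the other primes above `p`.
  set M := p ^ k + ∑ P ∈ primesAbove K p, e P + 1 with hM
  obtain ⟨c', hc', hresM⟩ := hres' M (by omega)
  rw [← absNorm_span_aeval hm hF hroot hgen] at hresM
  obtain ⟨hM0, hsum'⟩ := sum_residueDegree_mul_multiplicity hc' hresM
  have hlocal : ∀ P ∈ S, (∀ q : ℤ[X], aeval θ q ∈ P ↔ g ∣ q.map (Int.castRingHom (ZMod p))) ∧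
      g.natDegree ∣ residueDegree p P := fun P hP =>
    mem_iff_dvd_of_aeval_mem (Finset.mem_filter.1 hP).1 hg hirr hφ (Finset.mem_filter.1 hP).2
  have hp0 : (p : 𝓞 K) ≠ 0 := Nat.cast_ne_zero.2 hp.out.ne_zero
  have haevalM : aeval θ (φ ^ M + C (p : ℤ)) = aeval θ φ ^ M + p := by simp
  have hS1 : ∑ P ∈ S, residueDegree p P * t P = r * g.natDegree := by
    rw [← hsum]
    refine Finset.sum_subset (Finset.filter_subset _ _) fun P hP hPS => ?_
    rw [ht]
    simp only [multiplicity_eq_zero_of_notMem fun h => hPS (Finset.mem_filter.2 ⟨hP, h⟩), mul_zero]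
  have hS2 : ∑ P ∈ S, residueDegree p P * e P = p ^ k * g.natDegree := by
    rw [← hsum', ← Finset.sum_subset (Finset.filter_subset (fun P => aeval θ φ ∈ P)
      (primesAbove K p))]
    · refine Finset.sum_congr rfl fun P hP => ?_
      obtain ⟨hPa, hPφ⟩ := Finset.mem_filter.1 hP
      have hPp := prime_of_mem_primesAbove hPa
      have h1 := P.primeAddVal_eq_multiplicity hPp hM0
      have hve := P.primeAddVal_eq_multiplicity hPp hp0
      have hlt : P.primeAddVal hPp (p : 𝓞 K) < P.primeAddVal hPp (aeval θ φ ^ M) := by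
        rw [hve]
        refine lt_of_lt_of_le ?_ ((P.le_primeAddVal_iff hPp _ M).2 (Ideal.pow_mem_pow hPφ M))
        have : e P ≤ ∑ P ∈ primesAbove K p, e P :=
          Finset.single_le_sum (f := e) (fun _ _ => Nat.zero_le _) hPa
        exact_mod_cast (by omega : e P < M)
      rw [haevalM, AddValuation.map_add_eq_of_lt_right _ hlt, hve] at h1
      congr 1
      rw [haevalM]
      exact_mod_cast h1
    · intro P hP hPS
      rw [multiplicity_eq_zero_of_notMem, mul_zero]
      intro hmem
      refine hPS (Finset.mem_filter.2 ⟨hP, ?_⟩)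
      rw [haevalM] at hmem
      have h1 := P.sub_mem hmem (mem_primesAbove.1 hP).2
      rw [add_sub_cancel_right] at h1
      exact (mem_primesAbove.1 hP).1.mem_of_pow_mem _ h1
  have hlen : ∀ P, ∃ len, P ∈ S → e P = t P * len ∧
      (len = p ^ (k + 1 - r) ∨ ∃ j < r - 1, len = p ^ (k + 1 - r) * ((p - 1) * p ^ j)) := by
    intro P
    by_cases hP : P ∈ S
    · obtain ⟨len, h1, h2⟩ := multiplicity_of_trinomial_root hodd hr hrk hpa hpu haa' hroot hirr
        hgu hh hgh hψ hE (Finset.mem_filter.1 hP).1 (hlocal P hP).1 hφ0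
      exact ⟨len, fun _ => ⟨h1, h2⟩⟩
    · exact ⟨0, fun h => absurd h hP⟩
  choose len hlen using hlen
  have hd := hirr.natDegree_pos
  have hp3 : 3 ≤ p := by
    have := hp.out.two_le
    obtain ⟨j, hj⟩ := hodd
    omega
  -- Weight one forces both factors to be 1, in particular residue degree deg g.
  set w : Ideal (𝓞 K) → ℕ := fun P => residueDegree p P / g.natDegree * t P with hw
  have hwd : ∀ P ∈ S, w P * g.natDegree = residueDegree p P * t P := fun P hP => by
    rw [hw, mul_right_comm, Nat.div_mul_cancel (hlocal P hP).2]
  have key := Finset.card_weight_one S hp3 (q := p ^ (k + 1 - r)) (by positivity) (r - 1) w len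
    (fun P hP => (hlen P hP).2) (by
      rw [← pow_add, show k + 1 - r + (r - 1) = k by omega]
      refine Nat.eq_of_mul_eq_mul_right hd ?_
      rw [← hS2, Finset.sum_mul]
      refine Finset.sum_congr rfl fun P hP => ?_
      rw [mul_right_comm, hwd P hP, (hlen P hP).1, mul_assoc]) (by
      refine Nat.le_of_mul_le_mul_right ?_ hd
      rw [Nat.sub_add_cancel hr, ← hS1, Finset.sum_mul]
      exact (Finset.sum_congr rfl hwd).le)
  rw [Nat.sub_add_cancel hr] at key
  refine key.trans (Finset.card_le_card fun P hP => ?_)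
  obtain ⟨hPS, hPw⟩ := Finset.mem_filter.1 hP
  refine Finset.mem_filter.2 ⟨(Finset.mem_filter.1 hPS).1, ?_, (hlocal P hPS).1⟩
  exact (Nat.eq_of_dvd_of_div_eq_one (hlocal P hPS).2 (Nat.eq_one_of_mul_eq_one_right hPw)).symm

theorem mul_ncard_le_card_primes (θ : 𝓞 K) (r d : ℕ) (G : Set (ZMod p)[X])
    (hG : ∀ g ∈ G, g.Monic ∧ Irreducible g ∧ g.natDegree = d)
    (hr : ∀ g ∈ G, r ≤ (primesOverFactor p θ g).card) :
    r * G.ncard ≤ ((primesAbove K p).filter fun P => residueDegree p P = d).card := by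
  classical
  have hfin : G.Finite := (finite_setOf_natDegree_eq p d).subset fun g hg => (hG g hg).2.2
  lift G to Finset (ZMod p)[X] using hfin
  simp only [Finset.mem_coe] at hG hr
  rw [Set.ncard_coe_finset, mul_comm, ← smul_eq_mul]
  refine (Finset.card_nsmul_le_sum G _ r hr).trans ?_
  rw [← Finset.card_biUnion]
  · refine Finset.card_le_card fun P hP => ?_
    obtain ⟨g, hg, hP⟩ := Finset.mem_biUnion.1 hP
    obtain ⟨h1, h2, -⟩ := Finset.mem_filter.1 hP
    exact Finset.mem_filter.2 ⟨h1, h2.trans (hG g hg).2.2⟩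
  · intro g hg g' hg' hne
    rw [Function.onFun, Finset.disjoint_left]
    intro P hP hP'
    obtain ⟨-, -, h⟩ := Finset.mem_filter.1 hP
    obtain ⟨-, -, h'⟩ := Finset.mem_filter.1 hP'
    obtain ⟨q, hq⟩ := map_surjective (Int.castRingHom (ZMod p)) ZMod.intCast_surjective g
    have hdvd : g' ∣ g := by
      have := (h' q).1 ((h q).2 hq.symm.dvd)
      rwa [hq] at this
    exact hne (eq_of_monic_of_associated (hG g hg).1 (hG g' hg').1
      ((hG g' hg').2.1.associated_of_dvd (hG g hg).2.1 hdvd).symm)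

end Counting

/-! ### Valuations of differences of p-power type. -/

section PowerValuations

theorem exists_eq_pow_mul_of_le_emultiplicity {p : ℕ} {x : ℤ} {r : ℕ}
    (h : (r : ℕ∞) ≤ emultiplicity (p : ℤ) x) : ∃ c, x = p ^ r * c :=
  pow_dvd_iff_le_emultiplicity.2 h

variable {p : ℕ} [hp : Fact p.Prime]

theorem Int.dvd_pow_prime_sub_one {a : ℤ} (hpa : ¬ (p : ℤ) ∣ a) :
    (p : ℤ) ∣ a ^ (p - 1) - 1 := by
  have ha0 : (a : ZMod p) ≠ 0 := by rwa [Ne, ZMod.intCast_zmod_eq_zero_iff_dvd]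
  rw [← ZMod.intCast_zmod_eq_zero_iff_dvd]
  push_cast
  rw [ZMod.pow_card_sub_one_eq_one ha0, sub_self]

/-- Here p^k - 1 = (p - 1) s with s prime to `p`, so lifting the exponent from a^(p-1) gains
nothing. This identifies κ with the valuation of the coefficient a^(p^k) - a. -/
theorem Int.emultiplicity_pow_prime_pow_sub_self (hodd : Odd p) {a : ℤ} (hpa : ¬ (p : ℤ) ∣ a)
    {k : ℕ} (hk : k ≠ 0) :
    emultiplicity (p : ℤ) (a ^ p ^ k - a) = emultiplicity (p : ℤ) (a ^ (p - 1) - 1) := by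
  have hpp : Prime (p : ℤ) := Nat.prime_iff_prime_int.1 hp.out
  obtain ⟨s, hs⟩ : p - 1 ∣ p ^ k - 1 := by simpa using Nat.sub_dvd_pow_sub_pow p 1 k
  have hpk : p ^ k = (p - 1) * s + 1 := by
    rw [← hs, Nat.sub_add_cancel (Nat.one_le_pow _ _ hp.out.pos)]
  have hps : ¬ p ∣ s := fun h => hp.out.one_lt.not_ge (Nat.le_of_dvd one_pos
    ((Nat.dvd_add_right (h.mul_left (p - 1))).1 (hpk ▸ dvd_pow_self p hk)))
  have h1 : a ^ p ^ k - a = a * ((a ^ (p - 1)) ^ s - 1 ^ s) := by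
    rw [hpk, pow_succ, pow_mul, one_pow]; ring
  rw [h1, emultiplicity_mul hpp, emultiplicity_eq_zero.2 hpa, zero_add,
    Int.emultiplicity_pow_sub_pow hp.out hodd (Int.dvd_pow_prime_sub_one hpa)
      fun h => hpa (hpp.dvd_of_dvd_pow h),
    emultiplicity_eq_zero.2 hps, add_zero]

theorem Int.exists_add_pow_prime_pow (hodd : Odd p) {a : ℤ} (hpa : ¬ (p : ℤ) ∣ a) (k : ℕ) :
    ∃ w, ¬ (p : ℤ) ∣ w ∧ (a + p) ^ p ^ k = a ^ p ^ k + p ^ (k + 1) * w := by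
  have hpp : Prime (p : ℤ) := Nat.prime_iff_prime_int.1 hp.out
  have h : emultiplicity (p : ℤ) ((a + p) ^ p ^ k - a ^ p ^ k) = (k + 1 : ℕ) := by
    rw [Int.emultiplicity_pow_sub_pow hp.out hodd (by simp)
      fun h => hpa ((dvd_add_left (dvd_refl _)).1 h), add_sub_cancel_left,
      emultiplicity_pow_self hp.out.ne_zero hp.out.prime.not_isUnit,
      (by simpa using emultiplicity_pow_self hpp.ne_zero hpp.not_isUnit 1 :
        emultiplicity (p : ℤ) p = 1)]
    push_cast
    rw [add_comm]
  obtain ⟨⟨w, hw⟩, h2⟩ := emultiplicity_eq_coe.1 h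
  refine ⟨w, ?_, by linarith⟩
  rintro ⟨w', rfl⟩
  exact h2 ⟨w', by rw [hw]; ring⟩

theorem exists_eq_pow_mul_of_emultiplicity_eq {x : ℤ} {r : ℕ}
    (h : emultiplicity (p : ℤ) x = r) : ∃ c, x = p ^ r * c ∧ (c : ZMod p) ≠ 0 := by
  obtain ⟨⟨c, rfl⟩, h2⟩ := emultiplicity_eq_coe.1 h
  refine ⟨c, rfl, ?_⟩
  rw [Ne, ZMod.intCast_zmod_eq_zero_iff_dvd]
  rintro ⟨c', rfl⟩
  exact h2 ⟨c', by ring⟩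

/-- The cast respects a quotient when the denominator is nonzero modulo `p`, so the common p^r is
cancelled first. -/
theorem ratCast_div_eq {B C : ℤ} {r : ℕ} {β γ : ℤ} (hB : B = p ^ r * β) (hC : C = p ^ r * γ)
    (hγ : (γ : ZMod p) ≠ 0) : (((B : ℚ) / (C : ℚ) : ℚ) : ZMod p) = β / γ := by
  have hp0 : (p : ℚ) ≠ 0 := Nat.cast_ne_zero.2 hp.out.ne_zero
  have h1 : (B : ℚ) / (C : ℚ) = (β : ℚ) / (γ : ℚ) := by
    rw [hB, hC]
    push_cast
    exact mul_div_mul_left _ _ (pow_ne_zero _ hp0)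
  rw [h1, Rat.cast_div_of_ne_zero]
  · simp
  · simp
  · simpa using hγ

end PowerValuations

/-! ### Choice of a' under each of the four conditions. -/

section Factors

variable {p : ℕ} [hp : Fact p.Prime]

/-- The hypothesis on a factor `g` under which it contributes `r` primes. -/
def FactorHasLift (a b : ℤ) (m k r : ℕ) (g : (ZMod p)[X]) : Prop :=
  ∃ (a' : ℤ) (h : ℤ[X]), (a' : ZMod p) = a ∧
    C (a' ^ p ^ k - a) * X ^ m - C b = C ((p : ℤ) ^ r) * h ∧
    ¬ g ∣ h.map (Int.castRingHom (ZMod p))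

variable {a b : ℤ} {m k r : ℕ} {g : (ZMod p)[X]}

theorem factorHasLift_of_eq {s c : ℤ} (hs : a ^ p ^ k - a = p ^ r * s) (hc : b = p ^ r * c)
    (hg : ¬ g ∣ C (s : ZMod p) * X ^ m - C (c : ZMod p)) : FactorHasLift a b m k r g := by
  refine ⟨a, C s * X ^ m - C c, rfl, ?_, ?_⟩
  · rw [hs, hc, C_mul, C_mul]; ring
  · rwa [Polynomial.map_sub, Polynomial.map_mul, Polynomial.map_pow, map_X, map_C_intCast,
      map_C_intCast]

theorem not_dvd_C_mul_X_pow (hirr : Irreducible g) (hX : ¬ g ∣ X) {s : ZMod p} (hs : s ≠ 0) :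
    ¬ g ∣ C s * X ^ m := fun h =>
  (hirr.prime.dvd_or_dvd h).elim (not_dvd_C_of_irreducible hirr hs)
    fun h => hX (hirr.prime.dvd_of_dvd_pow h)

theorem factorHasLift_of_lt_left (hirr : Irreducible g) (hb : emultiplicity (p : ℤ) b = r)
    (ha : (r : ℕ∞) < emultiplicity (p : ℤ) (a ^ p ^ k - a)) : FactorHasLift a b m k r g := by
  obtain ⟨c, hc, hc0⟩ := exists_eq_pow_mul_of_emultiplicity_eq hb
  obtain ⟨s, hs⟩ := exists_eq_pow_mul_of_le_emultiplicity (p := p) (r := r + 1)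
    (by exact_mod_cast Order.add_one_le_of_lt ha)
  refine factorHasLift_of_eq (s := p * s) (by rw [hs]; ring) hc ?_
  have := not_dvd_C_of_irreducible hirr hc0
  simpa using this

theorem factorHasLift_of_lt_right (hirr : Irreducible g) (hX : ¬ g ∣ X)
    (ha : emultiplicity (p : ℤ) (a ^ p ^ k - a) = r)
    (hb : (r : ℕ∞) < emultiplicity (p : ℤ) b) : FactorHasLift a b m k r g := by
  obtain ⟨s, hs, hs0⟩ := exists_eq_pow_mul_of_emultiplicity_eq ha
  obtain ⟨c, hc⟩ := exists_eq_pow_mul_of_le_emultiplicity (p := p) (r := r + 1)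
    (by exact_mod_cast Order.add_one_le_of_lt hb)
  refine factorHasLift_of_eq (c := p * c) hs (by rw [hc]; ring) ?_
  have := not_dvd_C_mul_X_pow (m := m) hirr hX hs0
  simpa using this

/-- With a^(p^k) - a = p^r s and b = p^r c, the fraction reduces to -c/s. So s (x^m - c/s) is the
cofactor which g must not divide. -/
theorem factorHasLift_of_eq_of_not_dvd (hirr : Irreducible g) (hodd : Odd p)
    (ha : emultiplicity (p : ℤ) (a ^ p ^ k - a) = r) (hb : emultiplicity (p : ℤ) b = r)
    (hg : ¬ g ∣ X ^ m + C (((b : ℚ) / ((a : ℚ) + (-(a : ℚ)) ^ (p ^ k)) : ℚ) : ZMod p)) :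
    FactorHasLift a b m k r g := by
  obtain ⟨s, hs, hs0⟩ := exists_eq_pow_mul_of_emultiplicity_eq ha
  obtain ⟨c, hc, hc0⟩ := exists_eq_pow_mul_of_emultiplicity_eq hb
  refine factorHasLift_of_eq hs hc fun h => hg ?_
  have hden : ((a : ℚ) + (-(a : ℚ)) ^ (p ^ k)) = ((-(a ^ p ^ k - a) : ℤ) : ℚ) := by
    rw [hodd.pow.neg_pow]; push_cast; ring
  rw [hden, ratCast_div_eq (γ := -s) hc (by rw [hs]; ring) (by simpa using hs0)]
  refine (hirr.prime.dvd_or_dvd (?_ : g ∣ C (s : ZMod p) * _)).resolve_left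
    (not_dvd_C_of_irreducible hirr hs0)
  convert h using 1
  rw [mul_add, ← C_mul, sub_eq_add_neg, ← C_neg]
  congr 2
  push_cast
  field_simp

/-- If a' = a fails, a' = a + p works: it changes the cofactor by w x^m with w prime to `p`, which g
does not divide. -/
theorem factorHasLift_of_le (hirr : Irreducible g) (hX : ¬ g ∣ X) (hodd : Odd p)
    (hpa : ¬ (p : ℤ) ∣ a) (ha : ((k + 1 : ℕ) : ℕ∞) ≤ emultiplicity (p : ℤ) (a ^ p ^ k - a))
    (hb : ((k + 1 : ℕ) : ℕ∞) ≤ emultiplicity (p : ℤ) b) : FactorHasLift a b m k (k + 1) g := by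
  obtain ⟨s, hs⟩ := exists_eq_pow_mul_of_le_emultiplicity ha
  obtain ⟨c, hc⟩ := exists_eq_pow_mul_of_le_emultiplicity hb
  by_cases hg : g ∣ C (s : ZMod p) * X ^ m - C (c : ZMod p)
  · obtain ⟨w, hw, hpow⟩ := Int.exists_add_pow_prime_pow hodd hpa k
    refine ⟨a + p, C (s + w) * X ^ m - C c, by simp, ?_, fun h => ?_⟩
    · rw [hpow, show a ^ p ^ k + (p : ℤ) ^ (k + 1) * w - a = p ^ (k + 1) * (s + w) by
        linear_combination hs, hc, C_mul, C_mul]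
      ring
    · rw [Polynomial.map_sub, Polynomial.map_mul, Polynomial.map_pow, map_X, map_C_intCast,
        map_C_intCast, Int.cast_add, C_add] at h
      have h1 := dvd_sub h hg
      rw [show ((C (s : ZMod p) + C (w : ZMod p)) * X ^ m - C (c : ZMod p)) -
        (C (s : ZMod p) * X ^ m - C (c : ZMod p)) = C (w : ZMod p) * X ^ m by ring] at h1
      refine not_dvd_C_mul_X_pow hirr hX ?_ h1
      rwa [Ne, ZMod.intCast_zmod_eq_zero_iff_dvd]
  · exact factorHasLift_of_eq hs hc hg

end Factors

/-- The valuations `δ = ν_p(b)` and `κ = ν_p(a ^ (p - 1) - 1)` take values in `ℕ∞`, since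
`κ = ∞` when `a = ±1`. In the third condition the fraction is a `p`-adic unit, and the cast
`ℚ → ZMod p` (numerator over denominator) is its reduction modulo `p`. -/
theorem theorem2p7
    {K : Type*} [Field K] [NumberField K] (θ : K)
    (n m : ℕ) (a b : ℤ) (hm : 0 < m) (hmn : m < n)
    (hirr : Irreducible (X ^ n + C a * X ^ m + C b : ℤ[X]))
    (hroot : aeval θ (X ^ n + C a * X ^ m + C b : ℤ[X]) = 0)
    (hgen : IntermediateField.adjoin ℚ {θ} = ⊤)
    (p : ℕ) [Fact p.Prime] (hodd : Odd p)
    (hpa : ¬ (p : ℤ) ∣ a) (hpb : (p : ℤ) ∣ b) (hpnm : p ∣ n - m)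
    (u k : ℕ) (huk : n - m = u * p ^ k) (hpu : ¬ p ∣ u)
    (δ κ : ℕ∞) (hδ : δ = emultiplicity (p : ℤ) b)
    (hκ : κ = emultiplicity (p : ℤ) (a ^ (p - 1) - 1))
    (hcond : ∃ d : ℕ, 0 < d ∧
      ((δ < min κ ((k : ℕ∞) + 1) ∧
          (numIrred p d : ℕ∞) < δ * (numFactors p d u (a : ZMod p) : ℕ∞)) ∨
        (κ < min δ ((k : ℕ∞) + 1) ∧
          (numIrred p d : ℕ∞) < κ * (numFactors p d u (a : ZMod p) : ℕ∞)) ∨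
        (κ = δ ∧ δ ≤ (k : ℕ∞) ∧
          (numIrred p d : ℕ∞) < κ * (numFactorsAvoiding p d u (a : ZMod p) m
            (((b : ℚ) / ((a : ℚ) + (-(a : ℚ)) ^ (p ^ k)) : ℚ) : ZMod p) : ℕ∞)) ∨
        ((k : ℕ∞) + 1 ≤ min κ δ ∧
          numIrred p d < (k + 1) * numFactors p d u (a : ZMod p)))) :
    p ∣ fieldIndex K ∧ ¬ FieldIsMonogenic K := by
  have hp : p.Prime := Fact.out
  suffices h : p ∣ fieldIndex K from ⟨h, not_fieldIsMonogenic_of_dvd hp.ne_one h⟩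
  have ha0 : (a : ZMod p) ≠ 0 := by rwa [Ne, ZMod.intCast_zmod_eq_zero_iff_dvd]
  have hu0 : u ≠ 0 := fun h => hpu (by rw [h]; exact dvd_zero p)
  have hk : k ≠ 0 := by
    rintro rfl
    rw [huk, pow_zero, mul_one] at hpnm
    exact hpu hpnm
  obtain rfl : n = m + u * p ^ k := by omega
  have hmonic : (X ^ (m + u * p ^ k) + C a * X ^ m + C b : ℤ[X]).Monic := by
    rw [add_assoc]
    refine monic_X_pow_add ?_
    refine lt_of_le_of_lt ?_ (Nat.cast_lt.2 hmn)
    compute_degree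
    exact le_rfl
  obtain ⟨ϑ, rfl⟩ : ∃ ϑ : NumberField.RingOfIntegers K, (ϑ : K) = θ :=
    ⟨⟨θ, ⟨_, hmonic, hroot⟩⟩, rfl⟩
  have hrootϑ : aeval ϑ (X ^ (m + u * p ^ k) + C a * X ^ m + C b : ℤ[X]) = 0 := by
    apply NumberField.RingOfIntegers.coe_injective
    rw [map_zero, ← hroot]
    exact (aeval_algebraMap_apply K ϑ _).symm
  rw [← Int.emultiplicity_pow_prime_pow_sub_self hodd hpa hk] at hκ
  have hδ1 : 1 ≤ δ := by
    rw [hδ, Order.one_le_iff_pos]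
    exact emultiplicity_pos_of_dvd hpb
  have hκ1 : 1 ≤ κ := by
    rw [hκ, Int.emultiplicity_pow_prime_pow_sub_self hodd hpa hk, Order.one_le_iff_pos]
    exact emultiplicity_pos_of_dvd (Int.dvd_pow_prime_sub_one hpa)
  have key : ∀ (r d : ℕ) (G : Set (ZMod p)[X]), 1 ≤ r → r ≤ k + 1 →
      (∀ g ∈ G, g.Monic ∧ Irreducible g ∧ g.natDegree = d) →
      (∀ g ∈ G, g ∣ X ^ u + C (a : ZMod p)) → (∀ g ∈ G, FactorHasLift a b m k r g) →
      numIrred p d < r * G.ncard → p ∣ fieldIndex K := by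
    intro r d G hr1 hrk hG hGu hGl hlt
    refine dvd_fieldIndex_of_numIrred_lt d
      (hlt.trans_le (mul_ncard_le_card_primes ϑ r d G hG fun g hg => ?_))
    obtain ⟨a', h, haa', hh, hgh⟩ := hGl g hg
    exact le_card_primesOverFactor hodd hr1 hrk hpa hpb hpu haa' hmonic hirr hrootϑ hgen
      (hG g hg).1 (hG g hg).2.1 (hGu g hg) hh hgh
  have hX : ∀ g : (ZMod p)[X], Irreducible g → g ∣ X ^ u + C (a : ZMod p) → ¬ g ∣ X :=
    fun g hg hgu => not_dvd_X_of_dvd_X_pow_add_C hu0 ha0 hg hgu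
  let G : ℕ → Set (ZMod p)[X] := fun d =>
    {g | g.Monic ∧ Irreducible g ∧ g.natDegree = d ∧ g ∣ X ^ u + C (a : ZMod p)}
  obtain ⟨d, -, ⟨hlt, hN⟩ | ⟨hlt, hN⟩ | ⟨heq, hle, hN⟩ | ⟨hle, hN⟩⟩ := hcond
  · obtain ⟨hlt1, hlt2⟩ := lt_min_iff.1 hlt
    lift δ to ℕ using ne_top_of_lt hlt1
    refine key δ d (G d) (by exact_mod_cast hδ1) (by exact_mod_cast hlt2.le)
      (fun g hg => ⟨hg.1, hg.2.1, hg.2.2.1⟩) (fun g hg => hg.2.2.2)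
      (fun g hg => factorHasLift_of_lt_left hg.2.1 hδ.symm (hκ ▸ hlt1)) (by exact_mod_cast hN)
  · obtain ⟨hlt1, hlt2⟩ := lt_min_iff.1 hlt
    lift κ to ℕ using ne_top_of_lt hlt1
    refine key κ d (G d) (by exact_mod_cast hκ1) (by exact_mod_cast hlt2.le)
      (fun g hg => ⟨hg.1, hg.2.1, hg.2.2.1⟩) (fun g hg => hg.2.2.2)
      (fun g hg => factorHasLift_of_lt_right hg.2.1 (hX g hg.2.1 hg.2.2.2) hκ.symm (hδ ▸ hlt1))
      (by exact_mod_cast hN)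
  · subst heq
    lift κ to ℕ using ne_top_of_le_ne_top (ENat.natCast_ne_top k) hle
    have hle' : κ ≤ k := by exact_mod_cast hle
    refine key κ d {g | g.Monic ∧ Irreducible g ∧ g.natDegree = d ∧
      g ∣ X ^ u + C (a : ZMod p) ∧ ¬ g ∣ X ^ m +
        C (((b : ℚ) / ((a : ℚ) + (-(a : ℚ)) ^ (p ^ k)) : ℚ) : ZMod p)} (by exact_mod_cast hκ1) (by omega)
      (fun g hg => ⟨hg.1, hg.2.1, hg.2.2.1⟩) (fun g hg => hg.2.2.2.1)
      (fun g hg => factorHasLift_of_eq_of_not_dvd hg.2.1 hodd hκ.symm hδ.symm hg.2.2.2.2)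
      (by exact_mod_cast hN)
  · obtain ⟨hle1, hle2⟩ := le_min_iff.1 hle
    exact key (k + 1) d (G d) (by omega) le_rfl
      (fun g hg => ⟨hg.1, hg.2.1, hg.2.2.1⟩) (fun g hg => hg.2.2.2)
      (fun g hg => factorHasLift_of_le hg.2.1 (hX g hg.2.1 hg.2.2.2) hodd hpa
        (by rw [← hκ]; exact_mod_cast hle1) (by rw [← hδ]; exact_mod_cast hle2)) hN
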